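/- Let $\beta>2$ and $\rho\in(\tfrac12,1)$. Let $a_\rho:\mathbb R^2\to\{1,\beta\}$ be the $\mathbb Z^2$-periodic function that equals $\beta$ on the open square $\left(\tfrac{1-\rho}{2},\tfrac{1+\rho}{2}\right)^2$ and $1$ on the rest of $[0,1]^2$. For $\xi\in\mathbb R^2$ let $$\psi_\rho(\xi)=\lim_{\varepsilon\to0^+}\inf\left\{\int_0^1 a_\rho\!\left(\frac{\gamma(\tau)}{\varepsilon}\right)\|\gamma'(\tau)\|\,d\tau \;:\; \gamma\in W^{1,1}((0,1);\mathbb R^2),\ \gamma(0)=0,\ \gamma(1)=\xi\right\},$$ where $\|\cdot\|$ is the Euclidean norm (this is the asymptotic homogenisation formula for the limit metric). Put $\ell_\rho(x)=\sqrt{(1-\rho)^2+(x-(1-\rho))^2}$ and, for integers $M\ge N\ge1$ with $M=RN+S$, $R=\lfloor M/N\rfloor$, $$\mathscr L_\rho(M,N)=N\,\ell_\rho(1)+S\,\ell_\rho(R+1)+(N-S)\,\ell_\rho(R).$$ For real $x\ge y\ge0$ let $L_\rho(x,y)$ be given by the same formula, that is $$L_\rho(x,y)=y\,\ell_\rho(1)+(x-Ry)\,\ell_\rho(R+1)+(y-x+Ry)\,\ell_\rho(R),\qquad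 R=\lfloor x/y\rfloor,\quad\text{if } y>0,$$ and $L_\rho(x,0)=x$. Then $L_\rho$ is the continuous, positively $1$-homogeneous extension of $\mathscr L_\rho$ to $\{x\ge y\ge0\}$, the limit defining $\psi_\rho(\xi)$ exists for every $\xi$, and for all $(x,y)\in\mathbb R^2$ $$\psi_\rho(x,y)=L_\rho\big(\max\{|x|,|y|\},\min\{|x|,|y|\}\big).$$ -/

import Mathlib

open Filter Topology

/-- The coefficient `a_ρ` on `ℝ²`: it is `β` on the open square of side `ρ` centred in the unit
cell `[0,1]²`, it is `1` on the rest of the cell, and it is extended `ℤ²`-periodically. -/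
noncomputable def metricCoeff (β ρ : ℝ) (p : EuclideanSpace ℝ (Fin 2)) : ℝ :=
  open Classical in
  if Int.fract (p 0) ∈ Set.Ioo ((1 - ρ) / 2) ((1 + ρ) / 2) ∧
      Int.fract (p 1) ∈ Set.Ioo ((1 - ρ) / 2) ((1 + ρ) / 2) then β else 1

/-- The length of a curve at scale `ε`: the integral over `(0,1)` of `a_ρ(γ/ε) ‖γ'‖`. -/
noncomputable def scaledLength (β ρ ε : ℝ) (γ : ℝ → EuclideanSpace ℝ (Fin 2)) : ℝ :=
  ∫ τ in (0 : ℝ)..1, metricCoeff β ρ (ε⁻¹ • γ τ) * ‖deriv γ τ‖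

/-- The distance at scale `ε`: the infimum of the lengths of all `W^{1,1}(0,1)` curves from `p` to
`q`. In one dimension the (continuous representatives of) functions in `W^{1,1}(0,1)` are exactly
the absolutely continuous functions on `[0,1]`, with the almost everywhere derivative as the weak
derivative. -/
noncomputable def scaledDist (β ρ ε : ℝ) (p q : EuclideanSpace ℝ (Fin 2)) : ℝ :=
  sInf {c : ℝ | ∃ γ : ℝ → EuclideanSpace ℝ (Fin 2),
    AbsolutelyContinuousOnInterval γ 0 1 ∧ γ 0 = p ∧ γ 1 = q ∧ c = scaledLength β ρ ε γ}

/-- `ℓ_ρ(x) = √((1-ρ)² + (x-(1-ρ))²)`. -/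
noncomputable def segmentLength (ρ x : ℝ) : ℝ :=
  √((1 - ρ) ^ 2 + (x - (1 - ρ)) ^ 2)

/-- The explicit length `𝓛_ρ(M,N) = N ℓ_ρ(1) + S ℓ_ρ(R+1) + (N-S) ℓ_ρ(R)` for natural numbers
`M ≥ N ≥ 1`, where `M = R N + S` is division with remainder. -/
noncomputable def latticeLength (ρ : ℝ) (M N : ℕ) : ℝ :=
  (N : ℝ) * segmentLength ρ 1
    + ((M % N : ℕ) : ℝ) * segmentLength ρ (((M / N : ℕ) : ℝ) + 1)
    + ((N : ℝ) - ((M % N : ℕ) : ℝ)) * segmentLength ρ ((M / N : ℕ) : ℝ)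

/-- The extension `L_ρ` of `𝓛_ρ` to real `x ≥ y ≥ 0`: the same formula, with `R = ⌊x/y⌋` and
`S = x - R y`, for `y > 0`, and the limit value `x` for `y = 0`. -/
noncomputable def limitLength (ρ x y : ℝ) : ℝ :=
  if y = 0 then x
  else
    y * segmentLength ρ 1
      + (x - (⌊x / y⌋ : ℝ) * y) * segmentLength ρ ((⌊x / y⌋ : ℝ) + 1)
      + (y - (x - (⌊x / y⌋ : ℝ) * y)) * segmentLength ρ (⌊x / y⌋ : ℝ)

/-! The obstacles leave a grid of corridors of width `1 - ρ` on which the coefficient is `1`. On the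
cone `R ≤ x / y ≤ R + 1` the function `L_ρ` is linear, with coefficients `facetSlope ρ R` and
`facetHeight ρ R`. Since `ℓ_ρ` is convex, `L_ρ` is the maximum of these linear functions for `y >
0`.

Upper bound: a vector of that cone is a nonnegative combination of `(R, 1)` and `(R + 1, 1)`. A
lattice step `(k, 1)` is achieved by two segments inside corridors, of lengths `ℓ_ρ(k)` and
`ℓ_ρ(1)`, bending at obstacle corners (`reachable_step`). Repeating such steps reaches the target up
to an error `O(ε)` (`scaledDist_upper_bound`).

Lower bound: a calibration. `exists_calibration` gives a potential at bounded distance from the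
linear function of facet `R`, `1`-Lipschitz on each corridor and `2`-Lipschitz in the plane. As `2 ≤
β`, its derivative along a curve is almost everywhere at most the weighted speed
(`sub_le_scaledLength`), so its increment bounds the length from below. The potential is built on
the crossings of corridors from distances to obstacle corners (`crossingPotential_right`,
`crossingPotential_up`), then extended to each corridor, and finally to the obstacles. Symmetries of
the square reduce all directions to `0 ≤ y ≤ x`. -/

open MeasureTheory

/-- The Euclidean norm of the vector `(x, y)`. -/
noncomputable def planeNorm (x y : ℝ) : ℝ := √(x ^ 2 + y ^ 2)

/-! ### The Euclidean norm in coordinates -/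

namespace planeNorm

lemma nonneg (x y : ℝ) : 0 ≤ planeNorm x y := Real.sqrt_nonneg _

lemma sq (x y : ℝ) : planeNorm x y ^ 2 = x ^ 2 + y ^ 2 := Real.sq_sqrt (by positivity)

lemma comm (x y : ℝ) : planeNorm x y = planeNorm y x := by
  unfold planeNorm; rw [add_comm]

lemma inner_le (x y v w : ℝ) : x * v + y * w ≤ planeNorm x y * planeNorm v w := by
  have h1 := sq x y
  have h2 := sq v w
  refine (abs_le_of_sq_le_sq' ?_ (mul_nonneg (nonneg _ _) (nonneg _ _))).2
  rw [mul_pow, h1, h2]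
  nlinarith [sq_nonneg (x * w - y * v)]

lemma add_le (x y v w : ℝ) :
    planeNorm (x + v) (y + w) ≤ planeNorm x y + planeNorm v w := by
  refine (abs_le_of_sq_le_sq' ?_ (add_nonneg (nonneg _ _) (nonneg _ _))).2
  rw [add_sq, sq, sq, sq]
  nlinarith [inner_le x y v w]

lemma mul_left {c : ℝ} (hc : 0 ≤ c) (x y : ℝ) :
    planeNorm (c * x) (c * y) = c * planeNorm x y := by
  unfold planeNorm
  rw [show (c * x) ^ 2 + (c * y) ^ 2 = c ^ 2 * (x ^ 2 + y ^ 2) by ring,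
    Real.sqrt_mul (by positivity), Real.sqrt_sq hc]

lemma mono {x y v w : ℝ} (hx : |x| ≤ |v|) (hy : |y| ≤ |w|) : planeNorm x y ≤ planeNorm v w :=
  Real.sqrt_le_sqrt (add_le_add (sq_le_sq.2 hx) (sq_le_sq.2 hy))

lemma abs_left_le (x y : ℝ) : |x| ≤ planeNorm x y :=
  Real.abs_le_sqrt (by nlinarith [sq_nonneg y])

lemma abs_right_le (x y : ℝ) : |y| ≤ planeNorm x y :=
  Real.abs_le_sqrt (by nlinarith [sq_nonneg x])

lemma le_abs_add (x y : ℝ) : planeNorm x y ≤ |x| + |y| := by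
  refine (abs_le_of_sq_le_sq' ?_ (by positivity)).2
  rw [sq, add_sq, sq_abs, sq_abs]
  nlinarith [mul_nonneg (abs_nonneg x) (abs_nonneg y)]

lemma zero_right {x : ℝ} (hx : 0 ≤ x) : planeNorm x 0 = x := by
  unfold planeNorm; simp [Real.sqrt_sq hx]

/-- A path that bends at the corner `0` of a convex obstacle, from `-v` to `w`, is at most as long
as the path bending at a point `(-p, q)` on the far side of that corner. -/
lemma bend_le {v₁ v₂ w₁ w₂ p q : ℝ} (hv₁ : 0 ≤ v₁) (hv₂ : 0 < v₂) (hw₁ : 0 < w₁)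
    (hw₂ : 0 ≤ w₂) (hp : 0 ≤ p) (hq : 0 ≤ q) (h : v₁ * w₂ ≤ v₂ * w₁) :
    planeNorm v₁ v₂ + planeNorm w₁ w₂
      ≤ planeNorm (v₁ - p) (v₂ + q) + planeNorm (w₁ + p) (w₂ - q) := by
  set V := planeNorm v₁ v₂ with hV
  set W := planeNorm w₁ w₂ with hW
  have hV0 : 0 < V := hv₂.trans_le ((le_abs_self _).trans (abs_right_le _ _))
  have hW0 : 0 < W := hw₁.trans_le ((le_abs_self _).trans (abs_left_le _ _))
  have hVs : V ^ 2 = v₁ ^ 2 + v₂ ^ 2 := sq _ _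
  have hWs : W ^ 2 = w₁ ^ 2 + w₂ ^ 2 := sq _ _
  have h1 := inner_le (v₁ - p) (v₂ + q) v₁ v₂
  have h2 := inner_le (w₁ + p) (w₂ - q) w₁ w₂
  rw [← hV] at h1
  rw [← hW] at h2
  -- `h1` and `h2` project the displaced legs onto `v` and `w`. The first-order terms in `q` and `p`
  -- that remain have the right sign because `v / V` is steeper than `w / W`, which is `e1` and
  -- `e2`.
  have e1 : w₂ * V ≤ v₂ * W := by
    refine (abs_le_of_sq_le_sq' ?_ (by positivity)).2
    rw [mul_pow, mul_pow, hVs, hWs]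
    nlinarith [mul_self_le_mul_self (by positivity : 0 ≤ v₁ * w₂) h]
  have e2 : v₁ * W ≤ w₁ * V := by
    refine (abs_le_of_sq_le_sq' ?_ (by positivity)).2
    rw [mul_pow, mul_pow, hVs, hWs]
    nlinarith [mul_self_le_mul_self (by positivity : 0 ≤ v₁ * w₂) h]
  set X := planeNorm (v₁ - p) (v₂ + q)
  set Y := planeNorm (w₁ + p) (w₂ - q)
  have h3 : (V + W) * (V * W) ≤ (X + Y) * (V * W) := by
    nlinarith [mul_le_mul_of_nonneg_right h1 hW0.le, mul_le_mul_of_nonneg_right h2 hV0.le,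
      mul_le_mul_of_nonneg_left e1 hq, mul_le_mul_of_nonneg_left e2 hp]
  exact le_of_mul_le_mul_right h3 (by positivity)

end planeNorm

/-! ### Convexity of `ℓ_ρ` and the facets of `L_ρ` -/

section SegmentLength

variable {ρ : ℝ}

lemma segmentLength_eq (ρ x : ℝ) : segmentLength ρ x = planeNorm (1 - ρ) (x - (1 - ρ)) := rfl

/-- Convexity of `ℓ_ρ`, in a division-free form. -/
lemma segmentLength_convex {s t x y z : ℝ} (hs : 0 ≤ s) (ht : 0 ≤ t)
    (h : s * x + t * z = (s + t) * y) :
    (s + t) * segmentLength ρ y ≤ s * segmentLength ρ x + t * segmentLength ρ z := by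
  simp only [segmentLength_eq]
  rw [← planeNorm.mul_left hs, ← planeNorm.mul_left ht, ← planeNorm.mul_left (add_nonneg hs ht)]
  refine le_trans (le_of_eq ?_) (planeNorm.add_le _ _ _ _)
  congr 1
  · ring
  · linear_combination -h

lemma segmentLength_nonneg (ρ x : ℝ) : 0 ≤ segmentLength ρ x := Real.sqrt_nonneg _

lemma segmentLength_sq (ρ x : ℝ) :
    segmentLength ρ x ^ 2 = (1 - ρ) ^ 2 + (x - (1 - ρ)) ^ 2 := planeNorm.sq _ _

lemma sub_le_segmentLength (ρ x : ℝ) : x - (1 - ρ) ≤ segmentLength ρ x :=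
  (le_abs_self _).trans (planeNorm.abs_right_le _ _)

/-- The coefficient of `x` in the linear function that agrees with `L_ρ` on the cone
`R ≤ x / y ≤ R + 1`. -/
noncomputable def facetSlope (ρ : ℝ) (R : ℕ) : ℝ := segmentLength ρ (R + 1) - segmentLength ρ R

/-- The coefficient of `y` in the linear function that agrees with `L_ρ` on the cone
`R ≤ x / y ≤ R + 1`. -/
noncomputable def facetHeight (ρ : ℝ) (R : ℕ) : ℝ :=
  segmentLength ρ 1 + (segmentLength ρ R - facetSlope ρ R * R)

/-- The line through the graph points of a convex function at `R` and `R + 1` lies below the graph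
outside the interval between them, hence at every integer. -/
lemma facet_le_segmentLength (ρ : ℝ) (R m : ℕ) :
    facetSlope ρ R * m + facetHeight ρ R ≤ segmentLength ρ m + segmentLength ρ 1 := by
  unfold facetHeight facetSlope
  rcases le_or_gt m R with h | h
  · have hm : (m : ℝ) ≤ R := by exact_mod_cast h
    have := segmentLength_convex (ρ := ρ) (s := 1) (t := R - m) (x := m) (y := R) (z := R + 1)
      zero_le_one (by linarith) (by ring)
    nlinarith
  · have hm : (R : ℝ) + 1 ≤ m := by exact_mod_cast h
    have := segmentLength_convex (ρ := ρ) (s := m - R - 1) (t := 1) (x := R) (y := R + 1) (z := m)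
      (by linarith) zero_le_one (by ring)
    nlinarith

lemma facetSlope_le_one (ρ : ℝ) (R : ℕ) : facetSlope ρ R ≤ 1 := by
  have := planeNorm.add_le (1 - ρ) (R - (1 - ρ)) 0 1
  rw [add_zero, planeNorm.comm 0 1, planeNorm.zero_right zero_le_one] at this
  unfold facetSlope
  rw [segmentLength_eq, segmentLength_eq, show (R : ℝ) + 1 - (1 - ρ) = R - (1 - ρ) + 1 by ring]
  linarith

variable (hρ : ρ ∈ Set.Ioo (1 / 2 : ℝ) 1)

include hρ

lemma segmentLength_one_pos : 0 < segmentLength ρ 1 := by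
  have := sub_le_segmentLength ρ 1
  linarith [hρ.1]

/-- The derivative of `ℓ_ρ` at `1` is `ρ / ℓ_ρ(1)`. By convexity it is at most the derivative at `R`
(`h3`), which is at most the slope of the chord over `[R, R + 1]` (`h5`). -/
lemma le_segmentLength_one_mul_facetSlope {R : ℕ} (hR : 1 ≤ R) :
    ρ ≤ facetSlope ρ R * segmentLength ρ 1 := by
  have hR' : (1 : ℝ) ≤ R := by exact_mod_cast hR
  obtain ⟨h1, h2⟩ := hρ
  have hl : 0 < segmentLength ρ 1 := by linarith [sub_le_segmentLength ρ 1]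
  have hRl : 0 < segmentLength ρ R := by linarith [sub_le_segmentLength ρ R]
  have e1 := segmentLength_sq ρ 1
  have e2 := segmentLength_sq ρ R
  have h3 : ρ * segmentLength ρ R ≤ (R - (1 - ρ)) * segmentLength ρ 1 := by
    refine (abs_le_of_sq_le_sq' ?_ (mul_nonneg (by linarith) hl.le)).2
    rw [mul_pow, mul_pow, e1, e2]
    nlinarith [mul_nonneg (sq_nonneg (1 - ρ))
      (mul_nonneg (by linarith : (0 : ℝ) ≤ R - 1) (by linarith : (0 : ℝ) ≤ R - 1 + 2 * ρ))]
  have h4 := planeNorm.inner_le (1 - ρ) (R + 1 - (1 - ρ)) (1 - ρ) (R - (1 - ρ))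
  rw [← segmentLength_eq, ← segmentLength_eq] at h4
  have h5 : R - (1 - ρ) ≤ facetSlope ρ R * segmentLength ρ R := by
    unfold facetSlope; nlinarith
  have h6 := mul_le_mul_of_nonneg_right h5 hl.le
  have : ρ * segmentLength ρ R ≤ facetSlope ρ R * segmentLength ρ 1 * segmentLength ρ R := by
    linarith
  exact le_of_mul_le_mul_right this hRl

lemma facetSlope_nonneg {R : ℕ} (hR : 1 ≤ R) : 0 ≤ facetSlope ρ R := by
  have h := le_segmentLength_one_mul_facetSlope hρ hR
  have h1 := segmentLength_one_pos hρ
  by_contra! hn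
  nlinarith [hρ.1]

/-- The facet inequality at `m = 1` and the bound on the slope leave `2 ℓ_ρ(1)² - ρ ≤ ρ`, that is
`(1 - ρ) (1 - 2ρ) ≤ 0`; here `ρ > 1/2` enters. -/
lemma facetHeight_mul_le {R : ℕ} (hR : 1 ≤ R) : facetHeight ρ R * segmentLength ρ 1 ≤ ρ := by
  have h := le_segmentLength_one_mul_facetSlope hρ hR
  have h1 := segmentLength_one_pos hρ
  have h2 := facet_le_segmentLength ρ R 1
  have h3 := segmentLength_sq ρ 1
  rw [Nat.cast_one] at h2
  have h4 := mul_le_mul_of_nonneg_right h2 h1.le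
  nlinarith [hρ.1, hρ.2, mul_pos (by linarith [hρ.1] : 0 < 2 * ρ - 1) (sub_pos.2 hρ.2)]

/-- `R ℓ_ρ(R + 1)` and `(R + 1) ℓ_ρ(R)` are norms of vectors that differ by `(-(1 - ρ), 1 - ρ)`,
whose norm is at most `ℓ_ρ(1)` because `1 - ρ ≤ ρ`. -/
lemma facetHeight_nonneg (R : ℕ) : 0 ≤ facetHeight ρ R := by
  have h1 : planeNorm (1 - ρ) (-(1 - ρ)) ≤ segmentLength ρ 1 := by
    rw [segmentLength_eq]
    apply planeNorm.mono le_rfl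
    rw [abs_neg, abs_of_pos (by linarith [hρ.2]), abs_of_pos] <;> linarith [hρ.1]
  have h2 := planeNorm.add_le ((R : ℝ) * (1 - ρ) + (1 - ρ)) (R * (R + 1 - (1 - ρ)) + -(1 - ρ))
    (-(1 - ρ)) (1 - ρ)
  rw [show R * (1 - ρ) + (1 - ρ) + -(1 - ρ) = R * (1 - ρ) by ring,
    show R * (R + 1 - (1 - ρ)) + -(1 - ρ) + (1 - ρ) = R * (R + 1 - (1 - ρ)) by ring,
    planeNorm.mul_left (Nat.cast_nonneg R), ← segmentLength_eq,
    show R * (1 - ρ) + (1 - ρ) = (R + 1) * (1 - ρ) by ring,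
    show R * (R + 1 - (1 - ρ)) + -(1 - ρ) = (R + 1) * (R - (1 - ρ)) by ring,
    planeNorm.mul_left (by positivity), ← segmentLength_eq, planeNorm.comm (-(1 - ρ))] at h2
  unfold facetHeight facetSlope
  linarith

/-- Moving straight up by `n` raises the distance to a corner by at least `n * facetHeight`. -/
lemma planeNorm_add_facetHeight_le {R : ℕ} (hR : 1 ≤ R) {w t n : ℝ} (hw : 0 ≤ w)
    (hw' : w ≤ 1 - ρ) (ht : ρ ≤ t) (hn : 0 ≤ n) :
    planeNorm w t + n * facetHeight ρ R ≤ planeNorm w (t + n) := by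
  have hρ0 : 0 < ρ := by linarith [hρ.1]
  have hN : 0 < planeNorm w t := by
    have := (le_abs_self t).trans (planeNorm.abs_right_le w t); linarith
  -- The vertical derivative of the norm at `(w, t)` is `t / ‖(w, t)‖`; in the allowed range it is
  -- smallest at `(1 - ρ, ρ)`, where it equals `ρ / ℓ_ρ(1)`.
  have h1 : facetHeight ρ R * planeNorm w t ≤ t := by
    have h2 : ρ * planeNorm w t ≤ t * segmentLength ρ 1 := by
      rw [segmentLength_eq, ← planeNorm.mul_left (by linarith), ← planeNorm.mul_left (by linarith)]
      apply planeNorm.mono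
      · rw [abs_of_nonneg (by positivity), abs_of_nonneg (mul_nonneg (by linarith)
          (by linarith [hρ.2]))]
        nlinarith
      · rw [show t * (1 - (1 - ρ)) = ρ * t by ring]
    have h3 := mul_le_mul_of_nonneg_left h2 (facetHeight_nonneg hρ R)
    have h4 := mul_le_mul_of_nonneg_left (facetHeight_mul_le hρ hR) (hρ0.le.trans ht)
    have : facetHeight ρ R * planeNorm w t * ρ ≤ t * ρ := by linarith
    exact le_of_mul_le_mul_right this hρ0
  have h2 := planeNorm.inner_le w (t + n) w t
  have h3 := planeNorm.sq w t
  refine le_of_mul_le_mul_right ?_ hN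
  nlinarith

end SegmentLength

/-! ### The potential on the crossings -/

/-- The values, on the crossing `[-(1-ρ)/2, (1-ρ)/2]²` of two corridors, of a potential whose
increments bound lengths from below in the directions of the facet `R`. It is assembled from the
distances to the obstacle corners from which optimal paths arrive. -/
noncomputable def crossingPotential (ρ : ℝ) (R : ℕ) (x y : ℝ) : ℝ :=
  min (planeNorm (x + (1 - ρ) / 2) (y + 1 - (1 - ρ) / 2) - segmentLength ρ 1)
    (⨅ m : ℕ, (planeNorm (x - (1 - ρ) / 2 + (m + 1)) (y + (1 - ρ) / 2)
      - facetSlope ρ R * (m + 1)))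

section CrossingPotential

variable {ρ : ℝ} {R : ℕ}

lemma crossingPotential_bddBelow (ρ : ℝ) (R : ℕ) (x y : ℝ) :
    BddBelow (Set.range fun m : ℕ => planeNorm (x - (1 - ρ) / 2 + (m + 1)) (y + (1 - ρ) / 2)
      - facetSlope ρ R * (m + 1)) := by
  refine ⟨x - (1 - ρ) / 2, ?_⟩
  rintro _ ⟨m, rfl⟩
  have h1 := (le_abs_self _).trans
    (planeNorm.abs_left_le (x - (1 - ρ) / 2 + (m + 1)) (y + (1 - ρ) / 2))
  have h2 := mul_le_mul_of_nonneg_right (facetSlope_le_one ρ R) (by positivity : (0 : ℝ) ≤ m + 1)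
  simp only
  linarith

lemma crossingPotential_le_left (ρ : ℝ) (R : ℕ) (x y : ℝ) :
    crossingPotential ρ R x y
      ≤ planeNorm (x + (1 - ρ) / 2) (y + 1 - (1 - ρ) / 2) - segmentLength ρ 1 :=
  min_le_left _ _

lemma crossingPotential_le_right (ρ : ℝ) (R : ℕ) (x y : ℝ) (m : ℕ) :
    crossingPotential ρ R x y
      ≤ planeNorm (x - (1 - ρ) / 2 + (m + 1)) (y + (1 - ρ) / 2) - facetSlope ρ R * (m + 1) :=
  (min_le_right _ _).trans (ciInf_le (crossingPotential_bddBelow ρ R x y) m)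

lemma le_crossingPotential {c x y : ℝ}
    (h₁ : c ≤ planeNorm (x + (1 - ρ) / 2) (y + 1 - (1 - ρ) / 2) - segmentLength ρ 1)
    (h₂ : ∀ m : ℕ, c ≤ planeNorm (x - (1 - ρ) / 2 + (m + 1)) (y + (1 - ρ) / 2)
      - facetSlope ρ R * (m + 1)) : c ≤ crossingPotential ρ R x y :=
  le_min h₁ (le_ciInf h₂)

lemma crossingPotential_le_add (ρ : ℝ) (R : ℕ) (x y x' y' : ℝ) :
    crossingPotential ρ R x' y' ≤ crossingPotential ρ R x y + planeNorm (x' - x) (y' - y) := by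
  rw [← sub_le_iff_le_add]
  refine le_crossingPotential ?_ fun m => ?_
  · have h1 := crossingPotential_le_left ρ R x' y'
    have h2 := planeNorm.add_le (x + (1 - ρ) / 2) (y + 1 - (1 - ρ) / 2) (x' - x) (y' - y)
    ring_nf at h1 h2 ⊢
    linarith
  · have h1 := crossingPotential_le_right ρ R x' y' m
    have h2 := planeNorm.add_le (x - (1 - ρ) / 2 + (m + 1)) (y + (1 - ρ) / 2) (x' - x) (y' - y)
    ring_nf at h1 h2 ⊢
    linarith

variable (hρ : ρ ∈ Set.Ioo (1 / 2 : ℝ) 1) (hR : 1 ≤ R) {x y x' y' : ℝ}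
  (hx : |x| ≤ (1 - ρ) / 2) (hy : |y| ≤ (1 - ρ) / 2)
  (hx' : |x'| ≤ (1 - ρ) / 2) (hy' : |y'| ≤ (1 - ρ) / 2)

include hρ hx hy hx' hy'

/-- If the minimum at `(x, y)` comes from the corner below, bending instead at the lower right
corner of the crossing does not lengthen the path, and that corner is the source `m = n` of the
target. If it comes from the source `m` on the left, the same corner is the source `m + n + 1` of
the target and the triangle inequality suffices. -/
lemma crossingPotential_right (n : ℕ) :
    crossingPotential ρ R x' y' + facetSlope ρ R * (n + 1)
      ≤ crossingPotential ρ R x y + planeNorm (x' + (n + 1) - x) (y' - y) := by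
  rw [abs_le] at hx hy hx' hy'
  obtain ⟨hρ1, hρ2⟩ := hρ
  have hn : (0 : ℝ) ≤ n := Nat.cast_nonneg n
  rw [← sub_le_iff_le_add]
  refine le_crossingPotential ?_ fun m => ?_
  · have h1 := crossingPotential_le_right ρ R x' y' n
    have h2 := planeNorm.bend_le (v₁ := 1 - ρ) (v₂ := ρ) (w₁ := x' - (1 - ρ) / 2 + (n + 1))
      (w₂ := y' + (1 - ρ) / 2) (p := (1 - ρ) / 2 - x) (q := y + (1 - ρ) / 2) (by linarith)
      (by linarith) (by linarith) (by linarith) (by linarith) (by linarith)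
      (by nlinarith)
    have h3 : segmentLength ρ 1 = planeNorm (1 - ρ) ρ := by rw [segmentLength_eq]; ring_nf
    rw [h3]
    ring_nf at h1 h2 ⊢
    linarith
  · have h1 := crossingPotential_le_right ρ R x' y' (m + (n + 1))
    push_cast at h1
    have h2 := planeNorm.add_le (x - (1 - ρ) / 2 + (m + 1)) (y + (1 - ρ) / 2)
      (x' + (n + 1) - x) (y' - y)
    ring_nf at h1 h2 ⊢
    linarith

include hR

/-- From the corner below, climbing `n + 1` costs at least `(n + 1) * facetHeight`. From the source
`m` on the left, the path is compared with one bending at the upper left corner of the crossing,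
whose first leg is `ℓ_ρ(m + 1)`; the facet inequality at `m + 1` pays for the first unit of height,
and climbing pays for the other `n`. -/
lemma crossingPotential_up (n : ℕ) :
    crossingPotential ρ R x' y' + facetHeight ρ R * (n + 1)
      ≤ crossingPotential ρ R x y + planeNorm (x' - x) (y' + (n + 1) - y) := by
  rw [abs_le] at hx hy hx' hy'
  have hρ1 := hρ.1
  have hρ2 := hρ.2
  have hn : (0 : ℝ) ≤ n := Nat.cast_nonneg n
  have h1 := crossingPotential_le_left ρ R x' y'
  rw [← sub_le_iff_le_add]
  refine le_crossingPotential ?_ fun m => ?_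
  · have h2 := planeNorm.add_le (x + (1 - ρ) / 2) (y + 1 - (1 - ρ) / 2)
      (x' - x) (y' + (n + 1) - y)
    have h3 := planeNorm_add_facetHeight_le hρ hR (w := x' + (1 - ρ) / 2)
      (t := y' + 1 - (1 - ρ) / 2) (n := n + 1) (by linarith) (by linarith) (by linarith)
      (by linarith)
    ring_nf at h1 h2 h3 ⊢
    linarith
  · have hm : (0 : ℝ) ≤ m := Nat.cast_nonneg m
    have h2 := planeNorm.bend_le (v₁ := 1 - ρ) (v₂ := m + ρ) (w₁ := y' + 1 - (1 - ρ) / 2 + n)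
      (w₂ := x' + (1 - ρ) / 2) (p := (1 - ρ) / 2 - y) (q := x + (1 - ρ) / 2) (by linarith)
      (by linarith) (by linarith) (by linarith) (by linarith) (by linarith)
      (by nlinarith)
    have h3 := planeNorm_add_facetHeight_le hρ hR (w := x' + (1 - ρ) / 2)
      (t := y' + 1 - (1 - ρ) / 2) (n := n) (by linarith) (by linarith) (by linarith)
      (by linarith)
    have h4 := facet_le_segmentLength ρ R (m + 1)
    have h5 : segmentLength ρ ((m + 1 : ℕ) : ℝ) = planeNorm (1 - ρ) (m + ρ) := by
      rw [segmentLength_eq]; push_cast; ring_nf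
    rw [h5] at h4
    push_cast at h4
    rw [planeNorm.comm (y' + 1 - (1 - ρ) / 2 + n), planeNorm.comm (1 - ρ - _),
      planeNorm.comm (y' + 1 - (1 - ρ) / 2 + n + _)] at h2
    rw [planeNorm.comm (1 - ρ)] at h2 h4
    ring_nf at h1 h2 h3 h4 ⊢
    linarith

end CrossingPotential

section CrossingPotentialInt

variable {ρ : ℝ} {R : ℕ} (hρ : ρ ∈ Set.Ioo (1 / 2 : ℝ) 1) (hR : 1 ≤ R) {x y x' y' : ℝ}
  (hx : |x| ≤ (1 - ρ) / 2) (hy : |y| ≤ (1 - ρ) / 2)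
  (hx' : |x'| ≤ (1 - ρ) / 2) (hy' : |y'| ≤ (1 - ρ) / 2)

-- Points of a crossing differ by at most `1 - ρ` in each coordinate, while a shift by at least `1`
-- leaves a gap of at least `ρ ≥ 1 - ρ`. Backward displacements thus reduce to a single crossing.
include hρ in
lemma abs_sub_le_abs_add_int_sub {s t : ℝ} (hs : |s| ≤ (1 - ρ) / 2) (ht : |t| ≤ (1 - ρ) / 2)
    {n : ℤ} (hn : n ≤ 0) : |t - s| ≤ |t + n - s| := by
  rcases hn.eq_or_lt with rfl | hn
  · simp
  · have hn' : (n : ℝ) ≤ -1 := by exact_mod_cast Int.le_sub_one_of_lt hn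
    rw [abs_le] at hs ht
    have := hρ.1
    have h1 : |t - s| ≤ 1 - ρ := abs_le.2 ⟨by linarith, by linarith⟩
    have h2 := neg_le_abs (t + n - s)
    linarith

include hρ hR hx hy hx' hy'

lemma crossingPotential_right_int (n : ℤ) :
    crossingPotential ρ R x' y' + facetSlope ρ R * n
      ≤ crossingPotential ρ R x y + planeNorm (x' + n - x) (y' - y) := by
  rcases le_or_gt n 0 with hn | hn
  · have h1 := crossingPotential_le_add ρ R x y x' y'
    have h2 := planeNorm.mono (abs_sub_le_abs_add_int_sub hρ hx hx' hn) (le_refl |y' - y|)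
    have h3 : facetSlope ρ R * n ≤ 0 :=
      mul_nonpos_of_nonneg_of_nonpos (facetSlope_nonneg hρ hR) (by exact_mod_cast hn)
    linarith
  · obtain ⟨m, rfl⟩ : ∃ m : ℕ, n = m + 1 := ⟨(n - 1).toNat, by omega⟩
    exact_mod_cast crossingPotential_right hρ hx hy hx' hy' m

lemma crossingPotential_up_int (n : ℤ) :
    crossingPotential ρ R x' y' + facetHeight ρ R * n
      ≤ crossingPotential ρ R x y + planeNorm (x' - x) (y' + n - y) := by
  rcases le_or_gt n 0 with hn | hn
  · have h1 := crossingPotential_le_add ρ R x y x' y'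
    have h2 := planeNorm.mono (le_refl |x' - x|) (abs_sub_le_abs_add_int_sub hρ hy hy' hn)
    have h3 : facetHeight ρ R * n ≤ 0 :=
      mul_nonpos_of_nonneg_of_nonpos (facetHeight_nonneg hρ R) (by exact_mod_cast hn)
    linarith
  · obtain ⟨m, rfl⟩ : ∃ m : ℕ, n = m + 1 := ⟨(n - 1).toNat, by omega⟩
    exact_mod_cast crossingPotential_up hρ hR hx hy hx' hy' m

end CrossingPotentialInt

/-! ### Corridors and the calibrating potential -/

lemma LipschitzOnWith.congr_eqOn {α β : Type*} [PseudoEMetricSpace α] [PseudoEMetricSpace β]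
    {K : NNReal} {f g : α → β} {s : Set α} (hf : LipschitzOnWith K f s) (h : Set.EqOn g f s) :
    LipschitzOnWith K g s := fun x hx y hy => by
  rw [h hx, h hy]; exact hf hx hy

/-- Lipschitz functions on pieces of a space that overlap only in a set `D`, on which they are
prescribed, can be glued. -/
lemma exists_lipschitzOnWith_glue {α ι : Type*} [PseudoMetricSpace α] {K : NNReal} {D : Set α}
    {S : ι → Set α} (hS : ∀ i j, i ≠ j → S i ∩ S j ⊆ D) {f : α → ℝ}
    (hf : ∀ i, LipschitzOnWith K f (D ∩ S i)) :
    ∃ g : α → ℝ, Set.EqOn g f D ∧ ∀ i, LipschitzOnWith K g (S i) := by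
  classical
  choose h hhK hhf using fun i => (hf i).extend_real
  refine ⟨fun z => if z ∈ D then f z else if hz : ∃ i, z ∈ S i then h hz.choose z else 0,
    fun z hz => by simp [hz], fun i => ?_⟩
  refine (hhK i).lipschitzOnWith.congr_eqOn fun z hz => ?_
  by_cases hD : z ∈ D
  · simp only [hD, if_true]
    exact hhf i ⟨hD, hz⟩
  · have hex : ∃ i, z ∈ S i := ⟨i, hz⟩
    simp only [hD, if_false, hex, dif_pos]
    by_contra hne
    have : hex.choose ≠ i := fun h' => hne (by rw [h'])
    exact hD (hS _ _ this ⟨hex.choose_spec, hz⟩)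

/-- The Euclidean plane. -/
abbrev Plane := EuclideanSpace ℝ (Fin 2)

lemma Plane.norm_eq (p : Plane) : ‖p‖ = planeNorm (p 0) (p 1) := by
  rw [EuclideanSpace.norm_eq, Fin.sum_univ_two, Real.norm_eq_abs, Real.norm_eq_abs, sq_abs, sq_abs]
  rfl

lemma Plane.dist_eq (p q : Plane) : dist p q = planeNorm (p 0 - q 0) (p 1 - q 1) := by
  rw [dist_eq_norm, Plane.norm_eq]; rfl

/-- The corridor between two neighbouring lines of obstacles, on which the coordinate `i` stays
close to the integer `k`. -/
def corridor (ρ : ℝ) (i : Fin 2) (k : ℤ) : Set Plane := {p | |p i - k| ≤ (1 - ρ) / 2}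

lemma mem_corridor {ρ : ℝ} {i : Fin 2} {k : ℤ} {p : Plane} :
    p ∈ corridor ρ i k ↔ |p i - k| ≤ (1 - ρ) / 2 := Iff.rfl

section Corridor

variable {ρ : ℝ} (hρ : ρ ∈ Set.Ioo (1 / 2 : ℝ) 1)

include hρ

lemma round_eq_of_mem_corridor {i : Fin 2} {k : ℤ} {p : Plane} (hp : p ∈ corridor ρ i k) :
    round (p i) = k := by
  rw [mem_corridor, abs_le] at hp
  rw [round_eq_iff]
  constructor <;> linarith [hρ.1, hp.1, hp.2]

/-- The planar potential on the union of the crossings, extended in the corridors. -/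
lemma exists_potential_on_corridors {R : ℕ} (hR : 1 ≤ R) :
    ∃ u : Plane → ℝ, (∀ i j : ℤ, u !₂[(i : ℝ), (j : ℝ)] = crossingPotential ρ R 0 0
        + facetSlope ρ R * i + facetHeight ρ R * j) ∧
      ∀ i k, LipschitzOnWith 1 u (corridor ρ i k) := by
  set f : Plane → ℝ := fun p => crossingPotential ρ R (p 0 - round (p 0)) (p 1 - round (p 1))
    + facetSlope ρ R * round (p 0) + facetHeight ρ R * round (p 1) with hf
  -- `D` is the union of the crossings. Distinct corridors meet only there, so the extensions from
  -- `D` to the individual corridors are compatible.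
  set D : Set Plane := {p | ∀ i, |p i - round (p i)| ≤ (1 - ρ) / 2} with hD
  have key := exists_lipschitzOnWith_glue (K := 1) (D := D)
    (S := fun ik : Fin 2 × ℤ => corridor ρ ik.1 ik.2) (f := f) ?_ ?_
  · obtain ⟨u, hu, hL⟩ := key
    refine ⟨u, fun i j => ?_, fun i k => hL (i, k)⟩
    rw [hu]
    · simp [hf]
    · intro i
      have := hρ.2
      fin_cases i <;> simp <;> linarith
  · rintro ⟨i, k⟩ ⟨i', k'⟩ hne p ⟨hp, hp'⟩
    have h1 := round_eq_of_mem_corridor hρ hp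
    have h2 := round_eq_of_mem_corridor hρ hp'
    have hii : i ≠ i' := by
      rintro rfl
      exact hne (Prod.ext rfl (h1.symm.trans h2))
    intro l
    have hl : l = i ∨ l = i' := by omega
    rcases hl with rfl | rfl
    · simp only at h1; rw [h1]; exact hp
    · simp only at h2; rw [h2]; exact hp'
  · rintro ⟨i, k⟩
    refine LipschitzOnWith.of_le_add_mul 1 ?_
    rintro q ⟨hq, hqk⟩ p ⟨hp, hpk⟩
    have h1 := round_eq_of_mem_corridor hρ hqk
    have h2 := round_eq_of_mem_corridor hρ hpk
    rw [Plane.dist_eq, NNReal.coe_one, one_mul]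
    fin_cases i
    · have h := crossingPotential_up_int hρ hR (hp 0) (hp 1) (hq 0) (hq 1)
        (round (q 1) - round (p 1))
      simp only [Fin.zero_eta] at h1 h2
      simp only [hf, h1, h2] at h ⊢
      push_cast at h
      ring_nf at h ⊢
      linarith
    · have h := crossingPotential_right_int hρ hR (hp 0) (hp 1) (hq 0) (hq 1)
        (round (q 0) - round (p 0))
      simp only [Fin.mk_one] at h1 h2
      simp only [hf, h1, h2] at h ⊢
      push_cast at h
      ring_nf at h ⊢
      linarith

/-- Between two heights, a detour through a vertical corridor costs at most the side `ρ` of an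
obstacle. -/
lemma exists_detour (x x' : ℝ) : ∃ (c : ℝ) (k : ℤ), |c - k| ≤ (1 - ρ) / 2 ∧
    |x - c| + |c - x'| ≤ max |x - x'| ρ := by
  obtain ⟨h1, h2⟩ := hρ
  wlog h : x ≤ x' generalizing x x'
  · obtain ⟨c, k, hc, hx⟩ := this x' x (by linarith)
    refine ⟨c, k, hc, ?_⟩
    rw [abs_sub_comm x c, abs_sub_comm c x', abs_sub_comm x x', add_comm]
    exact hx
  have hx := Int.floor_le x
  have hx' := Int.lt_floor_add_one x
  set k := ⌊x⌋
  rcases le_or_gt x (k + (1 - ρ) / 2) with ha | ha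
  · refine ⟨x, k, abs_le.2 ⟨by linarith, by linarith⟩, ?_⟩
    simp
  rcases le_or_gt (k + 1 - (1 - ρ) / 2) x with hb | hb
  · refine ⟨x, k + 1, abs_le.2 ⟨by push_cast; linarith, by push_cast; linarith⟩, ?_⟩
    simp
  rcases le_or_gt (k + 1 - (1 - ρ) / 2) x' with hc | hc
  · refine ⟨k + 1 - (1 - ρ) / 2, k + 1, abs_le.2 ⟨by push_cast; linarith, by push_cast; linarith⟩,
      le_max_of_le_left ?_⟩
    rw [abs_of_nonpos (by linarith), abs_of_nonpos (by linarith), abs_of_nonpos (by linarith)]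
    linarith
  -- Both points lie beside the same obstacle. The detour goes round the end nearer to their
  -- midpoint, and its length is then at most `ρ`.
  rcases le_or_gt (x + x') (2 * k + 1) with hd | hd
  · refine ⟨k + (1 - ρ) / 2, k, abs_le.2 ⟨by linarith, by linarith⟩, le_max_of_le_right ?_⟩
    rw [abs_of_nonneg (by linarith), abs_of_nonpos (by linarith)]
    linarith
  · refine ⟨k + 1 - (1 - ρ) / 2, k + 1, abs_le.2 ⟨by push_cast; linarith, by push_cast; linarith⟩,
      le_max_of_le_right ?_⟩
    rw [abs_of_nonpos (by linarith), abs_of_nonneg (by linarith)]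
    linarith

/-- A function that is `1`-Lipschitz on each corridor is `2`-Lipschitz on their union. -/
lemma lipschitzOnWith_two_of_corridors {u : Plane → ℝ}
    (hu : ∀ i k, LipschitzOnWith 1 u (corridor ρ i k)) :
    LipschitzOnWith 2 u (⋃ i, ⋃ k, corridor ρ i k) := by
  have H (i k) (p q : Plane) (hp : p ∈ corridor ρ i k) (hq : q ∈ corridor ρ i k) :
      |u p - u q| ≤ planeNorm (p 0 - q 0) (p 1 - q 1) := by
    have := (hu i k).dist_le_mul p hp q hq
    rwa [NNReal.coe_one, one_mul, Plane.dist_eq, Real.dist_eq] at this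
  have H0 (i k) (p q : Plane) (hp : p ∈ corridor ρ i k) (hq : q ∈ corridor ρ i k) :
      |u p - u q| ≤ |p 0 - q 0| + |p 1 - q 1| := (H i k p q hp hq).trans (planeNorm.le_abs_add _ _)
  refine LipschitzOnWith.of_dist_le_mul fun p hp q hq => ?_
  simp only [Set.mem_iUnion] at hp hq
  obtain ⟨i, k, hp⟩ := hp
  obtain ⟨i', k', hq⟩ := hq
  rw [Plane.dist_eq, Real.dist_eq, NNReal.coe_ofNat]
  have hn0 := planeNorm.abs_left_le (p 0 - q 0) (p 1 - q 1)
  have hn1 := planeNorm.abs_right_le (p 0 - q 0) (p 1 - q 1)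
  by_cases hii : i = i'
  · subst hii
    by_cases hkk : k = k'
    · subst hkk
      linarith [H i k p q hp hq, planeNorm.nonneg (p 0 - q 0) (p 1 - q 1)]
    -- Distinct parallel corridors are at least `ρ` apart, so the detour of length `max _ ρ` is
    -- bounded by the distance; with the transverse displacement this gives the constant `2`.
    have hgap : ρ ≤ |p i - q i| := by
      have h1 : (1 : ℝ) ≤ |(k : ℝ) - k'| := by
        exact_mod_cast Int.one_le_abs (sub_ne_zero.2 hkk)
      rw [mem_corridor, abs_sub_comm] at hp
      rw [mem_corridor] at hq
      have h2 := abs_add_three ((k : ℝ) - p i) (p i - q i) (q i - k')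
      rw [show (k : ℝ) - p i + (p i - q i) + (q i - k') = k - k' by ring] at h2
      linarith
    fin_cases i
    · simp only [Fin.zero_eta] at hgap hp hq
      obtain ⟨c, l, hc, hd⟩ := exists_detour hρ (p 1) (q 1)
      have h1 := H0 0 k p !₂[p 0, c] hp (by simpa [mem_corridor] using hp)
      have h2 := H0 1 l !₂[p 0, c] !₂[q 0, c] (by simpa [mem_corridor] using hc)
        (by simpa [mem_corridor] using hc)
      have h3 := H0 0 k' !₂[q 0, c] q (by simpa [mem_corridor] using hq) hq
      simp only [Matrix.cons_val_zero, Matrix.cons_val_one, sub_self, abs_zero,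
        Matrix.cons_val_fin_one] at h1 h2 h3
      have h4 := abs_add_three (u p - u !₂[p 0, c]) (u !₂[p 0, c] - u !₂[q 0, c])
        (u !₂[q 0, c] - u q)
      rw [show u p - u !₂[p 0, c] + (u !₂[p 0, c] - u !₂[q 0, c]) + (u !₂[q 0, c] - u q)
        = u p - u q by ring] at h4
      have h5 : max |p 1 - q 1| ρ ≤ planeNorm (p 0 - q 0) (p 1 - q 1) :=
        max_le hn1 (hgap.trans hn0)
      linarith
    · simp only [Fin.mk_one] at hgap hp hq
      obtain ⟨c, l, hc, hd⟩ := exists_detour hρ (p 0) (q 0)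
      have h1 := H0 1 k p !₂[c, p 1] hp (by simpa [mem_corridor] using hp)
      have h2 := H0 0 l !₂[c, p 1] !₂[c, q 1] (by simpa [mem_corridor] using hc)
        (by simpa [mem_corridor] using hc)
      have h3 := H0 1 k' !₂[c, q 1] q (by simpa [mem_corridor] using hq) hq
      simp only [Matrix.cons_val_zero, Matrix.cons_val_one, sub_self, abs_zero,
        Matrix.cons_val_fin_one] at h1 h2 h3
      have h4 := abs_add_three (u p - u !₂[c, p 1]) (u !₂[c, p 1] - u !₂[c, q 1])
        (u !₂[c, q 1] - u q)
      rw [show u p - u !₂[c, p 1] + (u !₂[c, p 1] - u !₂[c, q 1]) + (u !₂[c, q 1] - u q)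
        = u p - u q by ring] at h4
      have h5 : max |p 0 - q 0| ρ ≤ planeNorm (p 0 - q 0) (p 1 - q 1) :=
        max_le hn0 (hgap.trans hn1)
      linarith
  · have key (p q : Plane) (k k' : ℤ) (hp : p ∈ corridor ρ 0 k) (hq : q ∈ corridor ρ 1 k') :
        |u p - u q| ≤ |p 0 - q 0| + |p 1 - q 1| := by
      have h1 := H0 0 k p !₂[p 0, q 1] hp (by simpa [mem_corridor] using hp)
      have h2 := H0 1 k' !₂[p 0, q 1] q (by simpa [mem_corridor] using hq) hq
      simp only [Matrix.cons_val_zero, Matrix.cons_val_one, sub_self, abs_zero,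
        Matrix.cons_val_fin_one] at h1 h2
      have h4 := abs_sub_le (u p) (u !₂[p 0, q 1]) (u q)
      linarith
    have h : |u p - u q| ≤ |p 0 - q 0| + |p 1 - q 1| := by
      have : (i = 0 ∧ i' = 1) ∨ (i = 1 ∧ i' = 0) := by omega
      rcases this with ⟨rfl, rfl⟩ | ⟨rfl, rfl⟩
      · exact key p q k k' hp hq
      · rw [abs_sub_comm (u p), abs_sub_comm (p 0), abs_sub_comm (p 1)]
        exact key q p k' k hq hp
    linarith

/-- Inside the obstacles the potential is any `2`-Lipschitz extension. At lattice points it differs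
from the linear function by a constant, and every point has a lattice point within `1/2` in each
coordinate. -/
lemma exists_calibration {R : ℕ} (hR : 1 ≤ R) :
    ∃ U : Plane → ℝ, LipschitzWith 2 U ∧ (∀ i k, LipschitzOnWith 1 U (corridor ρ i k)) ∧
      ∃ C, ∀ p, |U p - (facetSlope ρ R * p 0 + facetHeight ρ R * p 1)| ≤ C := by
  obtain ⟨u, hu, hL⟩ := exists_potential_on_corridors hρ hR
  obtain ⟨U, hU, hEq⟩ := (lipschitzOnWith_two_of_corridors hρ hL).extend_real
  refine ⟨U, hU, fun i k => (hL i k).congr_eqOn fun p hp => (hEq ?_).symm,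
    2 + |crossingPotential ρ R 0 0| + |facetSlope ρ R| + |facetHeight ρ R|, fun p => ?_⟩
  · exact Set.mem_iUnion_of_mem i (Set.mem_iUnion_of_mem k hp)
  set i := round (p 0) with hi
  set j := round (p 1) with hj
  have h0 : |p 0 - i| ≤ 1 / 2 := abs_sub_round _
  have h1 : |p 1 - j| ≤ 1 / 2 := abs_sub_round _
  set q : Plane := !₂[(i : ℝ), (j : ℝ)] with hq
  have hUq : U q = u q := by
    refine (hEq (Set.mem_iUnion_of_mem 0 (Set.mem_iUnion_of_mem i ?_))).symm
    simp [mem_corridor, hq]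
    linarith [hρ.2]
  have h2 : |U p - U q| ≤ 2 := by
    have h := hU.dist_le_mul p q
    rw [Real.dist_eq, Plane.dist_eq, NNReal.coe_ofNat] at h
    have h' := planeNorm.le_abs_add (p 0 - q 0) (p 1 - q 1)
    simp only [hq, Matrix.cons_val_zero, Matrix.cons_val_one,
      Matrix.cons_val_fin_one] at h h'
    linarith
  rw [hUq, hu] at h2
  have h3 : |facetSlope ρ R * (p 0 - i)| ≤ |facetSlope ρ R| := by
    rw [abs_mul]; exact mul_le_of_le_one_right (abs_nonneg _) (by linarith)
  have h4 : |facetHeight ρ R * (p 1 - j)| ≤ |facetHeight ρ R| := by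
    rw [abs_mul]; exact mul_le_of_le_one_right (abs_nonneg _) (by linarith)
  have h5 := le_abs_self (crossingPotential ρ R 0 0)
  have h6 := neg_abs_le (crossingPotential ρ R 0 0)
  rw [abs_le] at h2 h3 h4 ⊢
  constructor <;> linarith [h2.1, h2.2, h3.1, h3.2, h4.1, h4.2]

end Corridor

/-! ### The coefficient in terms of corridors -/

section MetricCoeff

variable {β ρ : ℝ}

lemma fract_mem_obstacle_iff (hρ : ρ < 1) (t : ℝ) :
    Int.fract t ∈ Set.Ioo ((1 - ρ) / 2) ((1 + ρ) / 2) ↔ ∀ k : ℤ, ¬ |t - k| ≤ (1 - ρ) / 2 := by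
  have h0 := Int.floor_add_fract t
  constructor
  · rintro ⟨h1, h2⟩ k hk
    rw [abs_le] at hk
    rcases le_or_gt k ⌊t⌋ with h | h
    · have : (k : ℝ) ≤ ⌊t⌋ := by exact_mod_cast h
      linarith
    · have : (⌊t⌋ : ℝ) + 1 ≤ k := by exact_mod_cast h
      linarith
  · intro h
    have h1 := h ⌊t⌋
    have h2 := h (⌊t⌋ + 1)
    have h3 := Int.fract_nonneg t
    have h4 := Int.fract_lt_one t
    push_cast at h2
    rw [not_le, lt_abs] at h1 h2
    constructor
    · rcases h1 with h1 | h1 <;> linarith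
    · rcases h2 with h2 | h2 <;> linarith

lemma mem_obstacle_iff (hρ : ρ < 1) (p : Plane) :
    (Int.fract (p 0) ∈ Set.Ioo ((1 - ρ) / 2) ((1 + ρ) / 2) ∧
      Int.fract (p 1) ∈ Set.Ioo ((1 - ρ) / 2) ((1 + ρ) / 2)) ↔ ∀ i k, p ∉ corridor ρ i k := by
  rw [fract_mem_obstacle_iff hρ, fract_mem_obstacle_iff hρ, Fin.forall_fin_two]
  rfl

lemma metricCoeff_of_mem_corridor (hρ : ρ < 1) {p : Plane} {i : Fin 2} {k : ℤ}
    (hp : p ∈ corridor ρ i k) : metricCoeff β ρ p = 1 :=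
  if_neg fun h => (mem_obstacle_iff hρ p).1 h i k hp

lemma metricCoeff_of_forall_notMem (hρ : ρ < 1) {p : Plane} (hp : ∀ i k, p ∉ corridor ρ i k) :
    metricCoeff β ρ p = β :=
  if_pos ((mem_obstacle_iff hρ p).2 hp)

lemma metricCoeff_nonneg (hβ : 0 ≤ β) (p : Plane) : 0 ≤ metricCoeff β ρ p := by
  unfold metricCoeff; split_ifs <;> simp [hβ]

lemma metricCoeff_le (hβ : 1 ≤ β) (p : Plane) : metricCoeff β ρ p ≤ β := by
  unfold metricCoeff; split_ifs <;> simp [hβ]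

lemma measurable_metricCoeff (β ρ : ℝ) : Measurable (metricCoeff β ρ) := by
  unfold metricCoeff
  have h (i : Fin 2) : Measurable fun p : Plane => Int.fract (p i) :=
    measurable_fract.comp (by fun_prop)
  exact Measurable.ite ((h 0 measurableSet_Ioo).inter (h 1 measurableSet_Ioo)) measurable_const
    measurable_const

end MetricCoeff

/-! ### Lower bound by calibration -/

/-- The isolated points of a set form a discrete subspace. Applied to the times a curve spends in a
corridor, this makes almost every such time an accumulation point of such times. -/
lemma countable_setOf_not_accPt {X : Type*} [TopologicalSpace X] [SecondCountableTopology X]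
    (S : Set X) : {x ∈ S | ¬ AccPt x (𝓟 S)}.Countable := by
  set N := {x ∈ S | ¬ AccPt x (𝓟 S)}
  have : DiscreteTopology N := discreteTopology_of_noAccPts fun x hx hacc =>
    hx.2 (hacc.mono (principal_mono.2 fun _ hy => hy.1))
  exact (TopologicalSpace.separableSpace_iff_countable (α := N)).1 inferInstance

/-- Comparison of derivatives along a set that accumulates at the point. -/
lemma abs_deriv_le_of_accPt {E : Type*} [NormedAddCommGroup E] [NormedSpace ℝ E] {g : ℝ → ℝ}
    {η : ℝ → E} {C t : ℝ} {S : Set ℝ} (hg : DifferentiableAt ℝ g t)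
    (hη : DifferentiableAt ℝ η t) (hS : AccPt t (𝓟 S))
    (h : ∀ s ∈ S, |g s - g t| ≤ C * ‖η s - η t‖) : |deriv g t| ≤ C * ‖deriv η t‖ := by
  have hne : (𝓝[S \ {t}] t).NeBot := accPt_principal_iff_nhdsWithin.1 hS
  have hle : 𝓝[S \ {t}] t ≤ 𝓝[≠] t := nhdsWithin_mono _ fun x hx => hx.2
  have h1 := ((hasDerivAt_iff_tendsto_slope.1 hg.hasDerivAt).mono_left hle).abs
  have h2 := (((hasDerivAt_iff_tendsto_slope.1 hη.hasDerivAt).mono_left hle).norm).const_mul C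
  refine le_of_tendsto_of_tendsto h1 h2 ?_
  filter_upwards [self_mem_nhdsWithin] with s hs
  rw [slope_def_module, slope_def_module, norm_smul, smul_eq_mul, abs_mul, Real.norm_eq_abs,
    mul_left_comm]
  exact mul_le_mul_of_nonneg_left (h s hs.1) (abs_nonneg _)

lemma LipschitzWith.comp_absolutelyContinuousOnInterval {X Y : Type*} [PseudoMetricSpace X]
    [PseudoMetricSpace Y] {K : NNReal} {U : X → Y} (hU : LipschitzWith K U) {γ : ℝ → X} {a b : ℝ}
    (hγ : AbsolutelyContinuousOnInterval γ a b) :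
    AbsolutelyContinuousOnInterval (fun t => U (γ t)) a b := by
  have h := Tendsto.const_mul (K : ℝ) hγ
  rw [mul_zero] at h
  refine squeeze_zero (fun _ => Finset.sum_nonneg fun _ _ => dist_nonneg) (fun E => ?_) h
  rw [Finset.mul_sum]
  exact Finset.sum_le_sum fun _ _ => hU.dist_le_mul _ _

lemma Plane.lipschitzWith_apply (i : Fin 2) : LipschitzWith 1 fun p : Plane => p i := by
  refine LipschitzWith.of_dist_le_mul fun p q => ?_
  rw [NNReal.coe_one, one_mul, Plane.dist_eq, Real.dist_eq]
  fin_cases i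
  · exact planeNorm.abs_left_le _ _
  · exact planeNorm.abs_right_le _ _

section ScaledLength

variable {β ρ ε : ℝ} {γ : ℝ → Plane}

lemma AbsolutelyContinuousOnInterval.intervalIntegrable_deriv_plane {a b : ℝ}
    (hγ : AbsolutelyContinuousOnInterval γ a b) : IntervalIntegrable (deriv γ) volume a b := by
  have hc (i : Fin 2) : AbsolutelyContinuousOnInterval (fun t => γ t i) a b :=
    (Plane.lipschitzWith_apply i).comp_absolutelyContinuousOnInterval hγ
  refine (((hc 0).intervalIntegrable_deriv.norm).add
    ((hc 1).intervalIntegrable_deriv.norm)).mono_fun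
    (measurable_deriv γ).aestronglyMeasurable (Eventually.of_forall fun t => ?_)
  have hnn : 0 ≤ ‖deriv (fun t => γ t 0) t‖ + ‖deriv (fun t => γ t 1) t‖ := by positivity
  beta_reduce
  rw [Real.norm_of_nonneg hnn]
  by_cases hd : DifferentiableAt ℝ γ t
  · have hi (i : Fin 2) : deriv (fun t => γ t i) t = deriv γ t i :=
      ((PiLp.proj (𝕜 := ℝ) 2 (fun _ : Fin 2 => ℝ) i).hasFDerivAt.comp_hasDerivAt t
        hd.hasDerivAt).deriv
    rw [hi, hi, Plane.norm_eq]
    exact planeNorm.le_abs_add _ _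
  · rw [deriv_zero_of_not_differentiableAt hd, norm_zero]
    exact hnn

lemma intervalIntegrable_scaledLength (hβ : 1 ≤ β) (ε : ℝ)
    (hγ : AbsolutelyContinuousOnInterval γ 0 1) :
    IntervalIntegrable (fun τ => metricCoeff β ρ (ε⁻¹ • γ τ) * ‖deriv γ τ‖) volume 0 1 := by
  refine (hγ.intervalIntegrable_deriv_plane.norm.const_mul β).mono_fun ?_
    (Eventually.of_forall fun t => ?_)
  · refine AEStronglyMeasurable.mul ?_ (measurable_deriv γ).norm.aestronglyMeasurable
    refine ((measurable_metricCoeff β ρ).comp_aemeasurable ?_).aestronglyMeasurable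
    refine ContinuousOn.aemeasurable ?_ measurableSet_uIoc
    exact (hγ.continuousOn.mono Set.uIoc_subset_uIcc).const_smul (ε⁻¹ : ℝ)
  · have h0 : 0 ≤ metricCoeff β ρ (ε⁻¹ • γ t) := metricCoeff_nonneg (by linarith) _
    simp only [norm_mul, norm_norm]
    rw [Real.norm_of_nonneg h0, Real.norm_of_nonneg (by linarith : 0 ≤ β)]
    exact mul_le_mul_of_nonneg_right (metricCoeff_le hβ _) (norm_nonneg _)

lemma scaledLength_nonneg (hβ : 0 ≤ β) (ε : ℝ) (γ : ℝ → Plane) : 0 ≤ scaledLength β ρ ε γ :=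
  intervalIntegral.integral_nonneg zero_le_one fun _ _ =>
    mul_nonneg (metricCoeff_nonneg hβ _) (norm_nonneg _)

/-- The constant `1` is available only between points of one corridor, which a curve may enter and
leave infinitely often. At almost every time in a corridor, the difference quotient can be taken
along other times in that corridor, which gives the bound with coefficient `1`; elsewhere the
constant `2 ≤ β` suffices. -/
lemma sub_le_scaledLength (hβ : 2 ≤ β) (hρ : ρ < 1) (hε : 0 < ε) {U : Plane → ℝ}
    (hU : LipschitzWith 2 U) (hUc : ∀ i k, LipschitzOnWith 1 U (corridor ρ i k))
    (hγ : AbsolutelyContinuousOnInterval γ 0 1) :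
    ε * (U (ε⁻¹ • γ 1) - U (ε⁻¹ • γ 0)) ≤ scaledLength β ρ ε γ := by
  set η : ℝ → Plane := fun t => ε⁻¹ • γ t with hη
  have hηac : AbsolutelyContinuousOnInterval η 0 1 := hγ.const_smul ε⁻¹
  have hg : AbsolutelyContinuousOnInterval (fun t => U (η t)) 0 1 :=
    hU.comp_absolutelyContinuousOnInterval hηac
  change ε * (U (η 1) - U (η 0)) ≤ _
  rw [← hg.integral_deriv_eq_sub, ← intervalIntegral.integral_const_mul]
  have hae (i : Fin 2) (k : ℤ) :
      ∀ᵐ t : ℝ, η t ∈ corridor ρ i k → AccPt t (𝓟 (η ⁻¹' corridor ρ i k)) := by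
    have := (countable_setOf_not_accPt (η ⁻¹' corridor ρ i k)).ae_notMem (volume : Measure ℝ)
    filter_upwards [this] with t ht hm
    by_contra hacc
    exact ht ⟨hm, hacc⟩
  have hae' := ae_all_iff.2 fun i => ae_all_iff.2 (hae i)
  refine intervalIntegral.integral_mono_ae_restrict zero_le_one
    (hg.intervalIntegrable_deriv.const_mul ε)
    (intervalIntegrable_scaledLength (by linarith) ε hγ) ?_
  rw [EventuallyLE, ae_restrict_iff' measurableSet_Icc]
  filter_upwards [hae', hg.ae_differentiableAt, hγ.boundedVariationOn.ae_differentiableAt_of_mem_uIcc]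
    with t hacc hdg hdγ ht
  rw [← Set.uIcc_of_le zero_le_one] at ht
  have hdη : DifferentiableAt ℝ η t := (hdγ ht).const_smul ε⁻¹
  have hnorm : ε * ‖deriv η t‖ = ‖deriv γ t‖ := by
    rw [hη, deriv_fun_const_smul _ (hdγ ht), norm_smul, norm_inv, Real.norm_of_nonneg hε.le,
      mul_inv_cancel_left₀ hε.ne']
  have key : deriv (fun t => U (η t)) t ≤ metricCoeff β ρ (η t) * ‖deriv η t‖ := by
    refine (le_abs_self _).trans ?_
    by_cases hc : ∀ i k, η t ∉ corridor ρ i k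
    · rw [metricCoeff_of_forall_notMem hρ hc]
      refine (abs_deriv_le_of_accPt (C := 2) (S := Set.univ) (hdg ht) hdη ?_
        fun s _ => ?_).trans (mul_le_mul_of_nonneg_right hβ (norm_nonneg _))
      · rw [accPt_principal_iff_nhdsWithin, ← Set.compl_eq_univ_sdiff]; infer_instance
      · have := hU.dist_le_mul (η s) (η t)
        rwa [Real.dist_eq, dist_eq_norm] at this
    · push Not at hc
      obtain ⟨i, k, hik⟩ := hc
      rw [metricCoeff_of_mem_corridor hρ hik]
      refine abs_deriv_le_of_accPt (hdg ht) hdη (hacc i k hik) fun s hs => ?_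
      have := (hUc i k).dist_le_mul (η s) hs (η t) hik
      rwa [Real.dist_eq, dist_eq_norm] at this
  calc ε * deriv (fun t => U (η t)) t ≤ ε * (metricCoeff β ρ (η t) * ‖deriv η t‖) :=
        mul_le_mul_of_nonneg_left key hε.le
    _ = metricCoeff β ρ (ε⁻¹ • γ t) * ‖deriv γ t‖ := by rw [← hnorm]; ring

lemma le_scaledDist {c : ℝ} {p q : Plane} (h : ∀ γ : ℝ → Plane,
    AbsolutelyContinuousOnInterval γ 0 1 → γ 0 = p → γ 1 = q → c ≤ scaledLength β ρ ε γ) :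
    c ≤ scaledDist β ρ ε p q := by
  -- A real infimum over the empty set would be `0`; the straight segment shows that there is a
  -- competitor.
  refine le_csInf ⟨_, AffineMap.lineMap p q, ?_, by simp, by simp, rfl⟩ ?_
  · exact (ContDiff.contDiffOn (by fun_prop)).absolutelyContinuousOnInterval
  · rintro _ ⟨γ, hγ, h0, h1, rfl⟩
    exact h γ hγ h0 h1

lemma scaledDist_le (hβ : 0 ≤ β) (hγ : AbsolutelyContinuousOnInterval γ 0 1) :
    scaledDist β ρ ε (γ 0) (γ 1) ≤ scaledLength β ρ ε γ := by
  refine csInf_le ⟨0, ?_⟩ ⟨γ, hγ, rfl, rfl, rfl⟩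
  rintro _ ⟨γ', -, -, -, rfl⟩
  exact scaledLength_nonneg hβ _ _

lemma scaledDist_lower_bound (hβ : 2 ≤ β) (hρ : ρ ∈ Set.Ioo (1 / 2 : ℝ) 1) {R : ℕ} (hR : 1 ≤ R) :
    ∃ C, ∀ ε : ℝ, 0 < ε → ∀ ξ : Plane,
      facetSlope ρ R * ξ 0 + facetHeight ρ R * ξ 1 - C * ε ≤ scaledDist β ρ ε 0 ξ := by
  obtain ⟨U, hU, hUc, C, hC⟩ := exists_calibration hρ hR
  refine ⟨2 * C, fun ε hε ξ => le_scaledDist fun γ hγ h0 h1 => ?_⟩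
  refine le_trans ?_ (sub_le_scaledLength hβ hρ.2 hε hU hUc hγ)
  have e1 := (abs_le.1 (hC (ε⁻¹ • γ 1))).1
  have e2 := (abs_le.1 (hC (ε⁻¹ • γ 0))).2
  rw [h1] at e1 ⊢
  rw [h0, smul_zero] at e2 ⊢
  simp only [PiLp.smul_apply, smul_eq_mul, PiLp.zero_apply, mul_zero, add_zero, sub_zero] at e1 e2
  have e3 : ε * (facetSlope ρ R * (ε⁻¹ * ξ 0) + facetHeight ρ R * (ε⁻¹ * ξ 1))
      = facetSlope ρ R * ξ 0 + facetHeight ρ R * ξ 1 := by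
    field_simp
  rw [← e3]
  nlinarith

/-- On the axis no facet is attained; the first coordinate itself is the calibration. -/
lemma apply_zero_le_scaledDist (hβ : 2 ≤ β) (hρ : ρ < 1) (hε : 0 < ε) (ξ : Plane) :
    ξ 0 ≤ scaledDist β ρ ε 0 ξ := by
  have hU := Plane.lipschitzWith_apply 0
  refine le_scaledDist fun γ hγ h0 h1 => ?_
  refine le_trans (le_of_eq ?_) (sub_le_scaledLength hβ hρ hε (hU.weaken one_le_two)
    (fun i k => hU.lipschitzOnWith) hγ)
  rw [h0, h1]
  simp [hε.ne']

end ScaledLength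

/-! ### Upper bound by explicit paths -/

/-- A curve from `p` to `q` that traverses the medium for a time `T`, with speed at most the
reciprocal of the coefficient. -/
def Reachable (β ρ T : ℝ) (p q : Plane) : Prop :=
  0 ≤ T ∧ ∃ γ : ℝ → Plane, LipschitzWith 1 γ ∧ γ 0 = p ∧ γ T = q ∧
    ∀ᵐ t : ℝ, t ∈ Set.Ioo 0 T → metricCoeff β ρ (γ t) * ‖deriv γ t‖ ≤ 1

section Reachable

variable {β ρ T T' : ℝ} {p q r : Plane}

lemma LipschitzWith.ite_le_sub {X : Type*} [PseudoMetricSpace X] {γ γ' : ℝ → X}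
    (h : LipschitzWith 1 γ) (h' : LipschitzWith 1 γ') (hT : γ T = γ' 0) :
    LipschitzWith 1 fun t => if t ≤ T then γ t else γ' (t - T) := by
  refine LipschitzWith.of_dist_le_mul fun s t => ?_
  wlog hst : s ≤ t generalizing s t
  · rw [dist_comm, dist_comm s]
    exact this t s (le_of_not_ge hst)
  rw [NNReal.coe_one, one_mul]
  have hd : dist s t = t - s := by rw [dist_comm, Real.dist_eq, abs_of_nonneg (by linarith)]
  by_cases ht : t ≤ T
  · have hs : s ≤ T := hst.trans ht
    simpa [hs, ht] using h.dist_le_mul s t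
  by_cases hs : s ≤ T
  · simp only [hs, ht, if_true, if_false]
    have h1 := h.dist_le_mul s T
    have h2 := h'.dist_le_mul 0 (t - T)
    rw [Real.dist_eq, abs_of_nonpos (by linarith)] at h1 h2
    rw [hT] at h1
    rw [NNReal.coe_one] at h1 h2
    have := dist_triangle (γ s) (γ' 0) (γ' (t - T))
    linarith
  · simpa [hs, ht] using h'.dist_le_mul (s - T) (t - T)

lemma Reachable.trans (h : Reachable β ρ T p q) (h' : Reachable β ρ T' q r) :
    Reachable β ρ (T + T') p r := by
  obtain ⟨hT, γ, hγ, h0, h1, hae⟩ := h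
  obtain ⟨hT', γ', hγ', h0', h1', hae'⟩ := h'
  refine ⟨add_nonneg hT hT', fun t => if t ≤ T then γ t else γ' (t - T),
    hγ.ite_le_sub hγ' (h1.trans h0'.symm), by simp [hT, h0], ?_, ?_⟩
  · rcases hT'.eq_or_lt with rfl | hpos
    · simp [h1, ← h0', h1']
    · simp [not_le.2 hpos, h1']
  · have hshift := (measurePreserving_sub_right volume T).quasiMeasurePreserving.ae hae'
    have hne : ∀ᵐ t : ℝ, t ≠ T := by simp [ae_iff, measure_singleton]
    filter_upwards [hae, hshift, hne] with t h1 h2 h3 ht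
    rcases lt_or_gt_of_ne h3 with h | h
    · have he : (fun t => if t ≤ T then γ t else γ' (t - T)) =ᶠ[𝓝 t] γ := by
        filter_upwards [Iio_mem_nhds h] with s hs
        exact if_pos (le_of_lt hs)
      rw [he.deriv_eq]
      simpa [h.le] using h1 ⟨ht.1, h⟩
    · have he : (fun t => if t ≤ T then γ t else γ' (t - T)) =ᶠ[𝓝 t] fun t => γ' (t - T) := by
        filter_upwards [Ioi_mem_nhds h] with s hs
        exact if_neg (not_le.2 hs)
      rw [he.deriv_eq, deriv_comp_sub_const]
      simpa [not_le.2 h] using h2 ⟨by linarith, by linarith [ht.2]⟩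

lemma Reachable.refl (β ρ : ℝ) (p : Plane) : Reachable β ρ 0 p p :=
  ⟨le_rfl, fun _ => p, LipschitzWith.const' p, rfl, rfl, by simp⟩

lemma metricCoeff_add_lattice (β ρ : ℝ) (p : Plane) (k l : ℤ) :
    metricCoeff β ρ (p + !₂[(k : ℝ), (l : ℝ)]) = metricCoeff β ρ p := by
  simp [metricCoeff]

lemma Reachable.add_lattice (h : Reachable β ρ T p q) (k l : ℤ) :
    Reachable β ρ T (p + !₂[(k : ℝ), (l : ℝ)]) (q + !₂[(k : ℝ), (l : ℝ)]) := by
  obtain ⟨hT, γ, hγ, h0, h1, hae⟩ := h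
  refine ⟨hT, fun t => γ t + !₂[(k : ℝ), (l : ℝ)], ?_, by simp [h0], by simp [h1], ?_⟩
  · exact LipschitzWith.of_dist_le_mul fun s t => by
      rw [dist_add_right]; exact hγ.dist_le_mul s t
  · filter_upwards [hae] with t ht hmem
    rw [deriv_add_const, metricCoeff_add_lattice]
    exact ht hmem

lemma Reachable.iterate_lattice {k l : ℤ} (h : Reachable β ρ T p (p + !₂[(k : ℝ), (l : ℝ)]))
    (n : ℕ) : Reachable β ρ (n * T) p (p + (n : ℝ) • !₂[(k : ℝ), (l : ℝ)]) := by
  induction n with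
  | zero => simpa using Reachable.refl β ρ p
  | succ n ih =>
    have h2 := h.add_lattice (n * k) (n * l)
    have e : (n : ℝ) • !₂[(k : ℝ), (l : ℝ)] = !₂[((n * k : ℤ) : ℝ), ((n * l : ℤ) : ℝ)] := by
      ext i; fin_cases i <;> simp
    rw [e] at ih
    have h3 := ih.trans h2
    convert h3 using 1
    · push_cast; ring
    · rw [← e, add_assoc]
      congr 1
      push_cast
      rw [add_smul, one_smul, add_comm]

lemma reachable_segment {c : ℝ} (hc : 1 ≤ c)
    (h : ∀ s ∈ Set.Icc (0 : ℝ) 1, metricCoeff β ρ (p + s • (q - p)) ≤ c) :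
    Reachable β ρ (c * ‖q - p‖) p q := by
  rcases eq_or_ne p q with rfl | hpq
  · simpa using Reachable.refl β ρ p
  have hn : 0 < ‖q - p‖ := norm_pos_iff.2 (sub_ne_zero.2 hpq.symm)
  have hT : 0 < c * ‖q - p‖ := by positivity
  set T := c * ‖q - p‖ with hTdef
  have hd (t : ℝ) : HasDerivAt (fun t : ℝ => p + (t / T) • (q - p)) ((1 / T) • (q - p)) t :=
    (((hasDerivAt_id t).div_const T).smul_const (q - p)).const_add p
  have hnorm : ‖(1 / T) • (q - p)‖ = c⁻¹ := by
    rw [norm_smul, Real.norm_of_nonneg (by positivity), hTdef]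
    field_simp
  refine ⟨hT.le, fun t => p + (t / T) • (q - p), ?_, by simp, ?_, ?_⟩
  · refine lipschitzWith_of_nnnorm_deriv_le (fun t => (hd t).differentiableAt) fun t => ?_
    rw [(hd t).deriv, ← NNReal.coe_le_coe, coe_nnnorm, hnorm, NNReal.coe_one]
    exact inv_le_one_of_one_le₀ hc
  · simp [div_self hT.ne']
  · refine Eventually.of_forall fun t ht => ?_
    rw [(hd t).deriv, hnorm]
    have := h (t / T) ⟨by have := ht.1; positivity, (div_le_one hT).2 ht.2.le⟩
    calc _ ≤ c * c⁻¹ := mul_le_mul_of_nonneg_right this (by positivity)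
      _ = 1 := mul_inv_cancel₀ (by positivity)

lemma reachable_corridor (hρ : ρ < 1) {i : Fin 2} {k : ℤ} (hp : p ∈ corridor ρ i k)
    (hq : q ∈ corridor ρ i k) : Reachable β ρ ‖q - p‖ p q := by
  have := reachable_segment (β := β) (ρ := ρ) (p := p) (q := q) le_rfl fun s hs => ?_
  · rwa [one_mul] at this
  refine (metricCoeff_of_mem_corridor hρ (i := i) (k := k) ?_).le
  rw [mem_corridor] at *
  have e : (p + s • (q - p)) i - k = (1 - s) * (p i - k) + s * (q i - k) := by
    simp only [PiLp.add_apply, PiLp.smul_apply, PiLp.sub_apply, smul_eq_mul]; ring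
  rw [e]
  refine (abs_add_le _ _).trans ?_
  rw [abs_mul, abs_mul, abs_of_nonneg hs.1, abs_of_nonneg (sub_nonneg.2 hs.2)]
  nlinarith [hs.1, hs.2]

lemma Reachable.scaledDist_le (hβ : 0 ≤ β) (h : Reachable β ρ T p q) {ε : ℝ} (hε : 0 < ε) :
    scaledDist β ρ ε (ε • p) (ε • q) ≤ ε * T := by
  obtain ⟨hT, γ, hγ, h0, h1, hae⟩ := h
  set σ : ℝ → Plane := fun t => ε • γ (T * t) with hσ
  have hL : LipschitzWith (‖ε‖₊ * (1 * ‖T‖₊)) σ :=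
    (lipschitzWith_smul ε).comp (hγ.comp (lipschitzWith_smul T))
  have hs0 : σ 0 = ε • p := by simp [hσ, h0]
  have hs1 : σ 1 = ε • q := by simp [hσ, h1]
  have hsd := _root_.scaledDist_le (ρ := ρ) (ε := ε) hβ
    (hL.lipschitzOnWith (s := Set.uIcc 0 1)).absolutelyContinuousOnInterval
  rw [hs0, hs1] at hsd
  refine hsd.trans ((le_abs_self _).trans ?_)
  have hbound : ∀ᵐ t : ℝ, t ∈ Set.uIoc (0 : ℝ) 1 →
      ‖metricCoeff β ρ (ε⁻¹ • σ t) * ‖deriv σ t‖‖ ≤ ε * T := by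
    have hder (t : ℝ) : deriv σ t = ε • T • deriv γ (T * t) := by
      rw [hσ, deriv_fun_const_smul_field, deriv_comp_mul_left]
    -- For `T = 0` the rescaling of time is constant and cannot transport an almost everywhere
    -- statement, but the derivative vanishes.
    rcases hT.eq_or_lt with rfl | hpos
    · refine Eventually.of_forall fun t _ => ?_
      rw [hder]; simp
    have hscale : ∀ᵐ t : ℝ, T * t ∈ Set.Ioo 0 T →
        metricCoeff β ρ (γ (T * t)) * ‖deriv γ (T * t)‖ ≤ 1 := by
      have hq : Measure.QuasiMeasurePreserving (fun t : ℝ => T * t) volume volume := by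
        refine ⟨measurable_const_mul T, ?_⟩
        rw [Real.map_volume_mul_left hpos.ne']
        exact Measure.smul_absolutelyContinuous
      exact hq.ae hae
    have hne : ∀ᵐ t : ℝ, t ≠ 1 := by simp [ae_iff, measure_singleton]
    filter_upwards [hscale, hne] with t ht ht1 hmem
    rw [Set.uIoc_of_le zero_le_one] at hmem
    have hlt : t < 1 := lt_of_le_of_ne hmem.2 ht1
    have h2 := ht ⟨mul_pos hpos hmem.1, by nlinarith⟩
    have h3 : 0 ≤ metricCoeff β ρ (γ (T * t)) := metricCoeff_nonneg hβ _
    rw [hder, hσ]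
    simp only [inv_smul_smul₀ hε.ne']
    rw [norm_mul, norm_norm, norm_smul, norm_smul, Real.norm_of_nonneg h3,
      Real.norm_of_nonneg hε.le, Real.norm_of_nonneg hpos.le]
    calc _ = ε * T * (metricCoeff β ρ (γ (T * t)) * ‖deriv γ (T * t)‖) := by ring
      _ ≤ ε * T * 1 := mul_le_mul_of_nonneg_left h2 (by positivity)
      _ = ε * T := mul_one _
  have := intervalIntegral.norm_integral_le_of_norm_le_const_ae hbound
  simpa [scaledLength] using this

/-- The elementary step of an optimal path: along a horizontal corridor past `k` obstacles, then
along a vertical corridor past one obstacle. -/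
lemma reachable_step (hρ : ρ < 1) (k : ℤ) :
    Reachable β ρ (segmentLength ρ k + segmentLength ρ 1) !₂[(1 - ρ) / 2, -((1 - ρ) / 2)]
      (!₂[(1 - ρ) / 2, -((1 - ρ) / 2)] + !₂[(k : ℝ), ((1 : ℤ) : ℝ)]) := by
  have h1 : |(1 - ρ) / 2| ≤ (1 - ρ) / 2 := by rw [abs_of_nonneg (by linarith)]
  have ha := reachable_corridor (β := β) hρ (i := 1) (k := 0)
    (p := !₂[(1 - ρ) / 2, -((1 - ρ) / 2)]) (q := !₂[(k : ℝ) - (1 - ρ) / 2, (1 - ρ) / 2])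
    (by simpa [mem_corridor] using h1) (by simpa [mem_corridor] using h1)
  have hb := reachable_corridor (β := β) hρ (i := 0) (k := k)
    (p := !₂[(k : ℝ) - (1 - ρ) / 2, (1 - ρ) / 2])
    (q := !₂[(1 - ρ) / 2, -((1 - ρ) / 2)] + !₂[(k : ℝ), ((1 : ℤ) : ℝ)])
    (by simpa [mem_corridor] using h1) (by simpa [mem_corridor] using h1)
  have := ha.trans hb
  rw [Plane.norm_eq, Plane.norm_eq] at this
  simp only [PiLp.sub_apply, PiLp.add_apply, Matrix.cons_val_zero, Matrix.cons_val_one,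
    Matrix.cons_val_fin_one, Int.cast_one] at this ⊢
  rw [segmentLength_eq, segmentLength_eq, planeNorm.comm (1 - ρ)]
  convert this using 3 <;> ring

lemma scaledDist_upper_bound (hβ : 1 ≤ β) (hρ : ρ < 1) (R : ℕ) {A B : ℝ} (hA : 0 ≤ A)
    (hB : 0 ≤ B) : ∃ C, ∀ ε : ℝ, 0 < ε →
      scaledDist β ρ ε 0 !₂[R * B + (R + 1) * A, A + B]
        ≤ B * (segmentLength ρ R + segmentLength ρ 1)
          + A * (segmentLength ρ (R + 1) + segmentLength ρ 1) + C * ε := by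
  set P : Plane := !₂[(1 - ρ) / 2, -((1 - ρ) / 2)] with hP
  set v : Plane := !₂[((R : ℤ) : ℝ), ((1 : ℤ) : ℝ)] with hv
  set w : Plane := !₂[((R + 1 : ℤ) : ℝ), ((1 : ℤ) : ℝ)] with hw
  have hseg (p q : Plane) : Reachable β ρ (β * ‖q - p‖) p q :=
    reachable_segment hβ fun s _ => metricCoeff_le hβ _
  -- The two terms pay, at the crude rate `β`, for the segment from `0` to the corner `P` and for
  -- the final segment that corrects `P` and the rounding of `B / ε` and `A / ε`.
  refine ⟨β * ‖P‖ + β * (‖P‖ + ‖v‖ + ‖w‖), fun ε hε => ?_⟩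
  set m := ⌊B / ε⌋₊
  set n := ⌊A / ε⌋₊
  set z : Plane := (B / ε) • v + (A / ε) • w with hz
  have hεz : ε • z = !₂[R * B + (R + 1) * A, A + B] := by
    rw [hz, smul_add, smul_smul, smul_smul, mul_div_cancel₀ _ hε.ne', mul_div_cancel₀ _ hε.ne']
    ext i
    fin_cases i
    · simp [hv, hw]; ring
    · simp [hv, hw]; ring
  have h1 : Reachable β ρ (m * (segmentLength ρ R + segmentLength ρ 1)) P (P + (m : ℝ) • v) := by
    have := reachable_step (β := β) hρ R
    rw [Int.cast_natCast] at this
    exact this.iterate_lattice m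
  have h2 : Reachable β ρ (n * (segmentLength ρ (R + 1) + segmentLength ρ 1)) P
      (P + (n : ℝ) • w) := by
    have := reachable_step (β := β) hρ (R + 1)
    have h := this.iterate_lattice n
    push_cast at h
    simpa [hw] using h
  have h3 := h2.add_lattice (m * R) (m * 1)
  have e : !₂[((m * R : ℤ) : ℝ), ((m * 1 : ℤ) : ℝ)] = (m : ℝ) • v := by
    ext i; fin_cases i <;> simp [hv]
  rw [e] at h3
  have h4 := (((hseg 0 P).trans h1).trans h3).trans (hseg _ z)
  have h5 := h4.scaledDist_le (by linarith) hε
  rw [smul_zero, hεz] at h5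
  refine h5.trans ?_
  have hm := Nat.floor_le (div_nonneg hB hε.le)
  have hn := Nat.floor_le (div_nonneg hA hε.le)
  have hm' := Nat.lt_floor_add_one (B / ε)
  have hn' := Nat.lt_floor_add_one (A / ε)
  have h6 : ‖z - (P + (n : ℝ) • w + (m : ℝ) • v)‖ ≤ ‖P‖ + ‖v‖ + ‖w‖ := by
    have : z - (P + (n : ℝ) • w + (m : ℝ) • v) = -P + (B / ε - m) • v + (A / ε - n) • w := by
      rw [hz, sub_smul, sub_smul]; abel
    rw [this]
    refine (norm_add₃_le).trans ?_
    rw [norm_neg, norm_smul, norm_smul, Real.norm_of_nonneg (sub_nonneg.2 hm),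
      Real.norm_of_nonneg (sub_nonneg.2 hn)]
    have := mul_le_of_le_one_left (norm_nonneg v) (by linarith : B / ε - m ≤ 1)
    have := mul_le_of_le_one_left (norm_nonneg w) (by linarith : A / ε - n ≤ 1)
    linarith
  have e1 : ε * m ≤ B := by rwa [mul_comm, ← le_div_iff₀ hε]
  have e2 : ε * n ≤ A := by rwa [mul_comm, ← le_div_iff₀ hε]
  have s1 := add_nonneg (segmentLength_nonneg ρ R) (segmentLength_nonneg ρ 1)
  have s2 := add_nonneg (segmentLength_nonneg ρ (R + 1)) (segmentLength_nonneg ρ 1)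
  have e3 := mul_le_mul_of_nonneg_right e1 s1
  have e4 := mul_le_mul_of_nonneg_right e2 s2
  have e5 := mul_le_mul_of_nonneg_left h6 (mul_nonneg hε.le (by linarith : 0 ≤ β))
  rw [sub_zero]
  nlinarith

lemma scaledDist_axis_le (hβ : 0 ≤ β) (hρ : ρ < 1) {x : ℝ} (hx : 0 ≤ x) {ε : ℝ} (hε : 0 < ε) :
    scaledDist β ρ ε 0 !₂[x, 0] ≤ x := by
  have hc : (0 : ℝ) ≤ (1 - ρ) / 2 := by linarith
  have h := reachable_corridor (β := β) hρ (i := 1) (k := 0) (p := 0) (q := ε⁻¹ • !₂[x, 0])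
    (by simpa [mem_corridor] using hc) (by simpa [mem_corridor] using hc)
  have h2 := h.scaledDist_le hβ hε
  rw [smul_zero, smul_inv_smul₀ hε.ne', sub_zero, norm_smul, Plane.norm_eq] at h2
  simp only [Matrix.cons_val_zero, Matrix.cons_val_one, Matrix.cons_val_fin_one] at h2
  rwa [planeNorm.zero_right hx, norm_inv, Real.norm_of_nonneg hε.le,
    mul_inv_cancel_left₀ hε.ne'] at h2

end Reachable

/-! ### Symmetries of the medium -/

section Symmetry

variable {β ρ : ℝ} {σ : Plane →ₗᵢ[ℝ] Plane}

lemma metricCoeff_comp_involutive (hρ : ρ < 1) (hσ : Function.Involutive σ)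
    (h : ∀ p i k, p ∈ corridor ρ i k → ∃ i' k', σ p ∈ corridor ρ i' k') (p : Plane) :
    metricCoeff β ρ (σ p) = metricCoeff β ρ p := by
  by_cases hp : ∃ i k, p ∈ corridor ρ i k
  · obtain ⟨i, k, hik⟩ := hp
    obtain ⟨i', k', hik'⟩ := h p i k hik
    rw [metricCoeff_of_mem_corridor hρ hik, metricCoeff_of_mem_corridor hρ hik']
  · push Not at hp
    rw [metricCoeff_of_forall_notMem hρ hp, metricCoeff_of_forall_notMem hρ fun i k hik => ?_]
    obtain ⟨i', k', hik'⟩ := h _ i k hik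
    rw [hσ p] at hik'
    exact hp i' k' hik'

lemma LinearIsometry.norm_deriv_comp_involutive (hσ : Function.Involutive σ) (γ : ℝ → Plane)
    (t : ℝ) : ‖deriv (fun t => σ (γ t)) t‖ = ‖deriv γ t‖ := by
  have hd {γ : ℝ → Plane} (h : DifferentiableAt ℝ γ t) :
      HasDerivAt (fun t => σ (γ t)) (σ (deriv γ t)) t :=
    σ.toContinuousLinearMap.hasFDerivAt.comp_hasDerivAt t h.hasDerivAt
  by_cases h : DifferentiableAt ℝ γ t
  · rw [(hd h).deriv, σ.norm_map]
  -- Because `σ` is an involution, `σ ∘ γ` is not differentiable either, so both derivatives take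
  -- the default value `0`.
  · rw [deriv_zero_of_not_differentiableAt h, deriv_zero_of_not_differentiableAt fun h' => h ?_]
    have := (hd h').differentiableAt
    simpa only [hσ _] using this

lemma scaledDist_comp_involutive (hβ : 0 ≤ β) (hσ : Function.Involutive σ)
    (h : ∀ p, metricCoeff β ρ (σ p) = metricCoeff β ρ p) (ε : ℝ) (ξ : Plane) :
    scaledDist β ρ ε 0 (σ ξ) = scaledDist β ρ ε 0 ξ := by
  have key (ξ : Plane) : scaledDist β ρ ε 0 (σ ξ) ≤ scaledDist β ρ ε 0 ξ := by
    refine le_scaledDist fun γ hγ h0 h1 => ?_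
    have hs := scaledDist_le (ρ := ρ) (ε := ε) hβ
      (σ.lipschitz.comp_absolutelyContinuousOnInterval hγ)
    rw [h0, h1, map_zero] at hs
    refine hs.trans (le_of_eq ?_)
    unfold scaledLength
    simp only [LinearIsometry.norm_deriv_comp_involutive hσ, ← map_smul, h]
  refine le_antisymm (key ξ) ?_
  have := key (σ ξ)
  rwa [hσ ξ] at this

/-- Reflection of the plane in the second axis. -/
noncomputable def planeReflect : Plane →ₗᵢ[ℝ] Plane where
  toFun p := !₂[-p 0, p 1]
  map_add' p q := by ext i; fin_cases i <;> simp [add_comm]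
  map_smul' c p := by ext i; fin_cases i <;> simp
  norm_map' p := by
    change ‖(!₂[-p 0, p 1] : Plane)‖ = _
    rw [Plane.norm_eq, Plane.norm_eq]; simp [planeNorm]

/-- Exchange of the two coordinates. -/
noncomputable def planeSwap : Plane →ₗᵢ[ℝ] Plane where
  toFun p := !₂[p 1, p 0]
  map_add' p q := by ext i; fin_cases i <;> simp
  map_smul' c p := by ext i; fin_cases i <;> simp
  norm_map' p := by
    change ‖(!₂[p 1, p 0] : Plane)‖ = _
    rw [Plane.norm_eq, Plane.norm_eq, planeNorm.comm]; simp

lemma planeReflect_apply (p : Plane) : planeReflect p = !₂[-p 0, p 1] := rfl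

lemma planeSwap_apply (p : Plane) : planeSwap p = !₂[p 1, p 0] := rfl

lemma scaledDist_planeReflect (hβ : 0 ≤ β) (hρ : ρ < 1) (ε : ℝ) (ξ : Plane) :
    scaledDist β ρ ε 0 (planeReflect ξ) = scaledDist β ρ ε 0 ξ := by
  have hinv : Function.Involutive planeReflect := fun p => by
    ext i; fin_cases i <;> simp [planeReflect_apply]
  refine scaledDist_comp_involutive hβ hinv
    (metricCoeff_comp_involutive hρ hinv fun p i k hp => ?_) ε ξ
  rw [mem_corridor] at hp
  fin_cases i
  · refine ⟨0, -k, ?_⟩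
    rw [mem_corridor, planeReflect_apply]
    simp only [Matrix.cons_val_zero, Int.cast_neg]
    rwa [← neg_add', abs_neg, ← sub_eq_add_neg]
  · exact ⟨1, k, hp⟩

lemma scaledDist_planeSwap (hβ : 0 ≤ β) (hρ : ρ < 1) (ε : ℝ) (ξ : Plane) :
    scaledDist β ρ ε 0 (planeSwap ξ) = scaledDist β ρ ε 0 ξ := by
  have hinv : Function.Involutive planeSwap := fun p => by
    ext i; fin_cases i <;> simp [planeSwap_apply]
  refine scaledDist_comp_involutive hβ hinv
    (metricCoeff_comp_involutive hρ hinv fun p i k hp => ?_) ε ξ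
  fin_cases i
  · exact ⟨1, k, hp⟩
  · exact ⟨0, k, hp⟩

end Symmetry

/-! ### `L_ρ` as a maximum of linear functions -/

section LimitLength

variable {ρ x y : ℝ}

lemma limitLength_zero_right (ρ x : ℝ) : limitLength ρ x 0 = x := if_pos rfl

lemma exists_facet (hy : 0 < y) (hyx : y ≤ x) : ∃ R : ℕ, 1 ≤ R ∧ R * y ≤ x ∧ x ≤ (R + 1) * y ∧
    limitLength ρ x y = y * segmentLength ρ 1 + (x - R * y) * segmentLength ρ (R + 1)
      + (y - (x - R * y)) * segmentLength ρ R := by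
  have h1 : 1 ≤ ⌊x / y⌋ := Int.le_floor.2 (by rw [Int.cast_one]; exact (one_le_div hy).2 hyx)
  obtain ⟨R, hR⟩ := Int.eq_ofNat_of_zero_le (zero_le_one.trans h1)
  have h2 := Int.floor_le (x / y)
  have h3 := Int.lt_floor_add_one (x / y)
  rw [hR, Int.cast_natCast] at h2 h3
  refine ⟨R, by omega, (le_div_iff₀ hy).1 h2, ((div_lt_iff₀ hy).1 h3).le, ?_⟩
  rw [limitLength, if_neg hy.ne', hR, Int.cast_natCast]

/-- `L_ρ` averages `ℓ_ρ(m) + ℓ_ρ(1)` and `ℓ_ρ(m + 1) + ℓ_ρ(1)` with nonnegative weights of sum `y`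
and barycentre `x / y`, and the facet inequality holds at both integers. -/
lemma facet_le_limitLength (ρ : ℝ) (hy : 0 ≤ y) (hyx : y ≤ x) (R : ℕ) :
    facetSlope ρ R * x + facetHeight ρ R * y ≤ limitLength ρ x y := by
  rcases hy.eq_or_lt with rfl | hy
  · rw [limitLength_zero_right]
    nlinarith [facetSlope_le_one ρ R]
  · obtain ⟨m, -, hm1, hm2, h⟩ := exists_facet (ρ := ρ) hy hyx
    have h1 := facet_le_segmentLength ρ R m
    have h2 := facet_le_segmentLength ρ R (m + 1)
    push_cast at h2
    rw [h]
    nlinarith [mul_le_mul_of_nonneg_left h1 (by linarith : 0 ≤ y - (x - m * y)),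
      mul_le_mul_of_nonneg_left h2 (by linarith : 0 ≤ x - m * y)]

lemma exists_limitLength_eq_facet (ρ : ℝ) (hy : 0 < y) (hyx : y ≤ x) :
    ∃ R : ℕ, 1 ≤ R ∧ limitLength ρ x y = facetSlope ρ R * x + facetHeight ρ R * y := by
  obtain ⟨R, hR, -, -, h⟩ := exists_facet (ρ := ρ) hy hyx
  refine ⟨R, hR, ?_⟩
  rw [h, facetHeight, facetSlope]
  ring

lemma le_limitLength (hρ : ρ ∈ Set.Ioo (1 / 2 : ℝ) 1) (hy : 0 ≤ y) (hyx : y ≤ x) :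
    x ≤ limitLength ρ x y := by
  rcases hy.eq_or_lt with rfl | hy
  · rw [limitLength_zero_right]
  · obtain ⟨m, -, hm1, hm2, h⟩ := exists_facet (ρ := ρ) hy hyx
    rw [h]
    have h1 : 1 - ρ ≤ segmentLength ρ 1 := by linarith [sub_le_segmentLength ρ 1, hρ.1]
    have h2 := sub_le_segmentLength ρ m
    have h3 := sub_le_segmentLength ρ (m + 1)
    nlinarith [mul_le_mul_of_nonneg_left h1 hy.le,
      mul_le_mul_of_nonneg_left h2 (by linarith : 0 ≤ y - (x - m * y)),
      mul_le_mul_of_nonneg_left h3 (by linarith : 0 ≤ x - m * y)]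

lemma limitLength_natCast (ρ : ℝ) {M N : ℕ} (hN : 1 ≤ N) :
    limitLength ρ M N = latticeLength ρ M N := by
  have hN0 : (N : ℝ) ≠ 0 := by positivity
  have hfl : ⌊(M : ℝ) / N⌋ = ((M / N : ℕ) : ℤ) := by
    rw [← Int.natCast_floor_eq_floor (by positivity), Nat.floor_div_eq_div]
  have hmod : ((M % N : ℕ) : ℝ) = M - ((M / N : ℕ) : ℝ) * N := by
    have := Nat.mod_add_div M N
    rw [eq_sub_iff_add_eq]
    exact_mod_cast (by rw [mul_comm (M / N)]; exact this)
  rw [limitLength, if_neg hN0, latticeLength, hfl, hmod, Int.cast_natCast]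

lemma limitLength_mul (ρ : ℝ) {t : ℝ} (ht : 0 < t) (x y : ℝ) :
    limitLength ρ (t * x) (t * y) = t * limitLength ρ x y := by
  by_cases hy : y = 0
  · simp [hy, limitLength_zero_right]
  · rw [limitLength, limitLength, if_neg hy, if_neg (mul_ne_zero ht.ne' hy),
      mul_div_mul_left _ _ ht.ne']
    ring

/-- The facet attained at one point bounds `L_ρ` from below at the other, and its coefficients lie
in `[0, 1]`. This yields the Lipschitz constant `2` for the sup distance; on the axis `x ≤ L_ρ`
replaces the facet. -/
lemma continuousOn_limitLength (hρ : ρ ∈ Set.Ioo (1 / 2 : ℝ) 1) :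
    ContinuousOn (fun p : ℝ × ℝ => limitLength ρ p.1 p.2) {p : ℝ × ℝ | 0 ≤ p.2 ∧ p.2 ≤ p.1} := by
  refine (LipschitzOnWith.of_le_add_mul 2 ?_).continuousOn
  rintro ⟨x, y⟩ ⟨hy, hyx⟩ ⟨x', y'⟩ ⟨hy', hyx'⟩
  simp only [NNReal.coe_ofNat] at *
  have h1 : x - x' ≤ dist (x, y) (x', y') := (le_abs_self _).trans (le_max_left _ _)
  have h2 : y - y' ≤ dist (x, y) (x', y') := (le_abs_self _).trans (le_max_right _ _)
  have hd : 0 ≤ dist (x, y) (x', y') := dist_nonneg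
  rcases hy.eq_or_lt with rfl | hy
  · rw [limitLength_zero_right]
    linarith [le_limitLength hρ hy' hyx']
  · obtain ⟨R, hR, h⟩ := exists_limitLength_eq_facet ρ hy hyx
    have h3 := facet_le_limitLength ρ hy' hyx' R
    have h4 : facetHeight ρ R ≤ 1 := by
      have := facetHeight_mul_le hρ hR
      have := sub_le_segmentLength ρ 1
      have hl := segmentLength_one_pos hρ
      refine le_of_mul_le_mul_right ?_ hl
      linarith
    have e1 := mul_le_mul_of_nonneg_left h1 (facetSlope_nonneg hρ hR)
    have e2 := mul_le_mul_of_nonneg_left h2 (facetHeight_nonneg hρ R)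
    have e3 := mul_le_mul_of_nonneg_right (facetSlope_le_one ρ R) hd
    have e4 := mul_le_mul_of_nonneg_right h4 hd
    rw [h]
    linarith

end LimitLength

/-! ### Existence and value of the limit -/

section Limit

variable {β ρ : ℝ}

lemma tendsto_scaledDist_of_le (hβ : 2 ≤ β) (hρ : ρ ∈ Set.Ioo (1 / 2 : ℝ) 1) {x y : ℝ}
    (hy : 0 ≤ y) (hyx : y ≤ x) :
    Tendsto (fun ε : ℝ => scaledDist β ρ ε 0 !₂[x, y]) (𝓝[>] 0) (𝓝 (limitLength ρ x y)) := by
  have hpos : ∀ᶠ ε : ℝ in 𝓝[>] 0, 0 < ε := self_mem_nhdsWithin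
  rcases hy.eq_or_lt with rfl | hy
  · rw [limitLength_zero_right]
    refine tendsto_const_nhds.congr' ?_
    filter_upwards [hpos] with ε hε
    exact le_antisymm (apply_zero_le_scaledDist hβ hρ.2 hε !₂[x, 0])
      (scaledDist_axis_le (by linarith) hρ.2 hyx hε)
  · obtain ⟨R, hR, h1, h2, h⟩ := exists_facet (ρ := ρ) hy hyx
    obtain ⟨C, hC⟩ := scaledDist_lower_bound hβ hρ hR
    obtain ⟨C', hC'⟩ := scaledDist_upper_bound (β := β) (by linarith) hρ.2 R
      (A := x - R * y) (B := y - (x - R * y)) (by linarith) (by linarith)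
    rw [show R * (y - (x - R * y)) + (R + 1) * (x - R * y) = x by ring,
      show x - R * y + (y - (x - R * y)) = y by ring] at hC'
    have hlim (c : ℝ) : Tendsto (fun ε : ℝ => limitLength ρ x y + c * ε) (𝓝[>] 0)
        (𝓝 (limitLength ρ x y)) := by
      refine Tendsto.mono_left ?_ nhdsWithin_le_nhds
      have : Continuous fun ε : ℝ => limitLength ρ x y + c * ε := by fun_prop
      simpa using this.tendsto 0
    refine tendsto_of_tendsto_of_tendsto_of_le_of_le' (hlim (-C)) (hlim C') ?_ ?_
    · filter_upwards [hpos] with ε hε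
      have := hC ε hε !₂[x, y]
      simp only [Matrix.cons_val_zero, Matrix.cons_val_one, Matrix.cons_val_fin_one] at this
      have e : facetSlope ρ R * x + facetHeight ρ R * y = limitLength ρ x y := by
        rw [h, facetHeight, facetSlope]; ring
      linarith
    · filter_upwards [hpos] with ε hε
      have := hC' ε hε
      rw [h]
      linarith

lemma tendsto_scaledDist (hβ : 2 ≤ β) (hρ : ρ ∈ Set.Ioo (1 / 2 : ℝ) 1) (ξ : Plane) :
    Tendsto (fun ε : ℝ => scaledDist β ρ ε 0 ξ) (𝓝[>] 0)
      (𝓝 (limitLength ρ (max |ξ 0| |ξ 1|) (min |ξ 0| |ξ 1|))) := by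
  have hβ0 : 0 ≤ β := by linarith
  wlog h1 : 0 ≤ ξ 1 generalizing ξ
  -- This composition changes the sign of the second coordinate.
  · have := this (planeSwap (planeReflect (planeSwap ξ)))
      (by simp [planeSwap_apply, planeReflect_apply]; linarith)
    simp only [scaledDist_planeSwap hβ0 hρ.2, scaledDist_planeReflect hβ0 hρ.2] at this
    simpa [planeSwap_apply, planeReflect_apply] using this
  wlog h0 : 0 ≤ ξ 0 generalizing ξ
  · have := this (planeReflect ξ) h1 (by simp [planeReflect_apply]; linarith)
    simp only [scaledDist_planeReflect hβ0 hρ.2] at this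
    simpa [planeReflect_apply] using this
  wlog h : ξ 1 ≤ ξ 0 generalizing ξ
  · have := this (planeSwap ξ) h0 h1 (le_of_not_ge h)
    simp only [scaledDist_planeSwap hβ0 hρ.2] at this
    simpa [planeSwap_apply, max_comm, min_comm] using this
  rw [abs_of_nonneg h0, abs_of_nonneg h1, max_eq_left h, min_eq_right h]
  have e : ξ = !₂[ξ 0, ξ 1] := by ext i; fin_cases i <;> rfl
  have := tendsto_scaledDist_of_le hβ hρ h1 h
  rwa [← e] at this

end Limit

theorem theorem1 (β ρ : ℝ) (hβ : 2 < β) (hρ : ρ ∈ Set.Ioo (1 / 2 : ℝ) 1) :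
    -- the limit in the asymptotic formula exists and has the asserted value
    (∀ ξ : EuclideanSpace ℝ (Fin 2),
      Tendsto (fun ε : ℝ => scaledDist β ρ ε 0 ξ) (𝓝[>] 0)
        (𝓝 (limitLength ρ (max |ξ 0| |ξ 1|) (min |ξ 0| |ξ 1|)))) ∧
    -- `L_ρ` is the continuous, positively homogeneous extension of `𝓛_ρ`
    (∀ M N : ℕ, 1 ≤ N → N ≤ M → limitLength ρ M N = latticeLength ρ M N) ∧
    (∀ t x y : ℝ, 0 < t → 0 ≤ y → y ≤ x →
      limitLength ρ (t * x) (t * y) = t * limitLength ρ x y) ∧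
    ContinuousOn (fun p : ℝ × ℝ => limitLength ρ p.1 p.2)
      {p : ℝ × ℝ | 0 ≤ p.2 ∧ p.2 ≤ p.1} :=
  ⟨tendsto_scaledDist hβ.le hρ, fun _ _ hN _ => limitLength_natCast ρ hN,
    fun _ x y ht _ _ => limitLength_mul ρ ht x y, continuousOn_limitLength hρ⟩
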